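/- Let $n\ge 2$ and write $y=(y',y_n)\in\mathbf C^{n-1}\times\mathbf C$. Let $r(y,\xi')=\sum_{j,k=1}^{n-1}G_{jk}(y)\xi_j\xi_k$, where the $G_{jk}$ are holomorphic in an open neighborhood $W$ of $0\in\mathbf C^n$ and $(G_{jk}(y))$ is real, symmetric and positive definite for real $y\in W$ (the principal symbol, holomorphically continued, of the tangential part $R(y,D_{y'})$ of $-P=D_{y_n}^2+R(y,D_{y'})$, in analytic coordinates in which the domain is $y_n>0$). Let $\eta_0'\in\mathbf R^{n-1}$ with the normalization $r(0,\eta_0')=\tfrac14$. Let $\phi(y,\xi')$, holomorphic in an open neighborhood $U\subset W\times\mathbf C^{n-1}$ of $(0,\eta_0')$ that is conic (invariant under $(y,\xi')\mapsto(y,\lambda\xi')$, $\lambda>0$), solve the Hamilton–Jacobi problem $$\partial_{y_n}\phi=i\,r(y,\phi'_{y'})^{1/2},\qquad \phi(y',0,\xi')=y'\cdot\xi',$$ with the principal branch of the square root. Put $\psi(y,\xi')=\phi(y,\xi')-y'\cdot\xi'$, $\phi^*(y,\eta')=\overline{\phi(\overline y,\overline{\eta'})}$, $\psi^*(y,\eta')=\phi^*(y,\eta')-y'\cdot\eta'$,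 and let $$\Phi(x',t,y;\eta')=\psi(y,t\eta_0')-\psi^*(y,\eta')+(x'-y')\cdot(\eta'-t\eta_0')$$ (with $(y,t\eta_0')\in U$, $(\overline y,\overline{\eta'})\in U$) be the phase, with fiber variables $\eta'$, of the operator $q\mapsto\sigma_{\dot\Lambda}(x',t\eta_0')$, the symbol of the linearized Dirichlet-to-Neumann operator restricted to the ray. Then its canonical relation $$C=\{(x',t,\partial_{x'}\Phi,\partial_t\Phi;\;y,-\partial_y\Phi)\,:\ \partial_{\eta'}\Phi=0\}$$ is equal to $$\begin{aligned}\{(&y'+\partial_{\eta'}\psi^*(y,\eta'),\,t,\,\eta'-t\eta_0',\,\eta_0'\cdot\partial_{\xi'}\psi(y,t\eta_0')-\eta_0'\cdot\partial_{\eta'}\psi^*(y,\eta');\\&y,\,-\partial_{y'}\psi(y,t\eta_0')+\partial_{y'}\psi^*(y,\eta')+\eta'-t\eta_0',\,-\partial_{y_n}\psi(y,t\eta_0')+\partial_{y_n}\psi^*(y,\eta'))\},\end{aligned}$$ where $(y,t,\eta')$ runs through all values with $(y,t\eta_0')\in U$ and $(\overline y,\overline{\eta'})\in U$, and it is locally the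 graph of a bijective canonical transformation $\kappa_{\mathrm{new}}$: there are open neighborhoods $A$ of $(y;y^*)=(0;0,-i)$ in $\mathbf C^n_y\times\mathbf C^n_{y^*}$ and $B$ of $(x',t;x'^*,t^*)=(0,1;0,0)$ in $\mathbf C^n_{x',t}\times\mathbf C^n_{x'^*,t^*}$ and a biholomorphic bijection $\kappa_{\mathrm{new}}:A\to B$, preserving the canonical complex symplectic forms $\sum dy_j^*\wedge dy_j$ and $\sum dx_j'^*\wedge dx_j'+dt^*\wedge dt$, with $\kappa_{\mathrm{new}}(0;0,-i)=(0,1;0,0)$, such that $$C\cap(B\times A)=\{(\kappa_{\mathrm{new}}(\rho),\rho):\ \rho\in A\}.$$ Moreover $A$ and $B$ are conic, i.e. invariant under the respective actions $(y,y^*)\mapsto(y,\lambda y^*)$ and $(x',t,x'^*,t^*)\mapsto(x',\lambda t,\lambda x'^*,t^*)$ of $\lambda\in\mathbf R_+$, and $\kappa_{\mathrm{new}}$ intertwines these two actions (it is positively homogeneous of degree 1, with fiber variables $y^*$ on the departure side and $t,x'^*$ on the arrival side). -/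

import Mathlib

noncomputable section

namespace DNSymbol

/-- `ℂⁿ = ℂ^{n-1} × ℂ` with `n - 1 = d`: points `y = (y', y_n)`, and also points `(x', t)`. -/
abbrev Cn (d : ℕ) : Type := (Fin d → ℂ) × ℂ

/-- The complex cotangent space `ℂⁿ × ℂⁿ`: points `(base point, covector)`. -/
abbrev TCn (d : ℕ) : Type := Cn d × Cn d

/-- The holomorphic gradient `(∂_{y'} f, ∂_{y_n} f)` on `ℂ^{n-1} × ℂ`. -/
def grad {d : ℕ} (f : Cn d → ℂ) (y : Cn d) : Cn d :=
  (fun j => fderiv ℂ f y (Pi.single j 1, 0), fderiv ℂ f y (0, 1))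

/-- The holomorphic gradient in the fibre variables `ξ' ∈ ℂ^{n-1}`. -/
def fgrad {d : ℕ} (f : (Fin d → ℂ) → ℂ) (ξ : Fin d → ℂ) : Fin d → ℂ :=
  fun j => fderiv ℂ f ξ (Pi.single j 1)

/-- The inclusion `ℝ^{n-1} → ℂ^{n-1}`. -/
def realVec {d : ℕ} (a : Fin d → ℝ) : Fin d → ℂ := fun j => (a j : ℂ)

/-- The principal symbol `r(y, ξ') = ∑ G_{jk}(y) ξ_j ξ_k`, holomorphically continued (it is
bilinear, not sesquilinear, in `ξ'`). -/
def symbol {d : ℕ} (G : Cn d → Matrix (Fin d) (Fin d) ℂ) (y : Cn d) (ξ : Fin d → ℂ) : ℂ :=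
  ∑ j, ∑ k, G y j k * ξ j * ξ k

/-- `G` is the holomorphic continuation to the complex neighbourhood `W` of `0` of the
(real-analytic, real, positive definite) coefficients of the principal symbol of a second order
elliptic operator `R(y, D_{y'})`. -/
structure IsEllipticSymbol {d : ℕ} (W : Set (Cn d))
    (G : Cn d → Matrix (Fin d) (Fin d) ℂ) : Prop where
  isOpen : IsOpen W
  zero_mem : (0 : Cn d) ∈ W
  holomorphic : ∀ j k, DifferentiableOn ℂ (fun y => G y j k) W
  real_posDef : ∀ (a : Fin d → ℝ) (b : ℝ), ((realVec a, (b : ℂ)) : Cn d) ∈ W →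
    ∃ A : Matrix (Fin d) (Fin d) ℝ, A.PosDef ∧
      ∀ j k, G (realVec a, (b : ℂ)) j k = (A j k : ℂ)

/-- `φ` is a holomorphic solution, on the conic neighbourhood `U` of `(0, η₀)`, of the
Hamilton-Jacobi problem `∂_{y_n} φ = i r(y, ∂_{y'} φ)^{1/2}`, `φ(y', 0, ξ') = y' · ξ'`, where the
square root is the principal one (the cut is the negative real axis). -/
structure IsHJSolution {d : ℕ} (W : Set (Cn d)) (G : Cn d → Matrix (Fin d) (Fin d) ℂ)
    (η₀ : Fin d → ℝ) (U : Set (Cn d × (Fin d → ℂ))) (φ : Cn d → (Fin d → ℂ) → ℂ) : Prop where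
  isOpen : IsOpen U
  base_mem : ((0 : Cn d), realVec η₀) ∈ U
  conic : ∀ y ξ, (y, ξ) ∈ U → ∀ c : ℝ, 0 < c → (y, (c : ℂ) • ξ) ∈ U
  subset : ∀ y ξ, (y, ξ) ∈ U → y ∈ W
  holomorphic : DifferentiableOn ℂ (fun p : Cn d × (Fin d → ℂ) => φ p.1 p.2) U
  eikonal : ∀ y ξ, (y, ξ) ∈ U →
    (grad (fun z => φ z ξ) y).2 =
      Complex.I * (symbol G y (grad (fun z => φ z ξ) y).1) ^ (1 / 2 : ℂ)
  initial : ∀ (y' ξ : Fin d → ℂ), ((y', (0 : ℂ)), ξ) ∈ U → φ (y', 0) ξ = dotProduct y' ξ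

/-- Complex conjugation on `ℂ^{n-1}`. -/
def conjVec {d : ℕ} (ξ : Fin d → ℂ) : Fin d → ℂ := fun j => (starRingEnd ℂ) (ξ j)

/-- Complex conjugation on `ℂ^{n-1} × ℂ`. -/
def conjCn {d : ℕ} (y : Cn d) : Cn d := (conjVec y.1, (starRingEnd ℂ) y.2)

/-- `f*(z) = conj (f (conj z))`. -/
def starFun {d : ℕ} (f : Cn d → (Fin d → ℂ) → ℂ) (y : Cn d) (η : Fin d → ℂ) : ℂ :=
  (starRingEnd ℂ) (f (conjCn y) (conjVec η))

/-- `ψ(y, ξ') = φ(y, ξ') - y' · ξ'`. -/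
def psi {d : ℕ} (φ : Cn d → (Fin d → ℂ) → ℂ) (y : Cn d) (ξ : Fin d → ℂ) : ℂ :=
  φ y ξ - dotProduct y.1 ξ

/-- `ψ*(y, η') = φ*(y, η') - y' · η'`. -/
def psiStar {d : ℕ} (φ : Cn d → (Fin d → ℂ) → ℂ) (y : Cn d) (η : Fin d → ℂ) : ℂ :=
  starFun φ y η - dotProduct y.1 η

/-- The phase, as a function of `X = (x', t)`, `y` and the fibre variables `η'`:
`ψ(y, tη₀') - ψ*(y, η') + (x' - y') · (η' - tη₀')`. -/
def phase {d : ℕ} (η₀ : Fin d → ℝ) (φ : Cn d → (Fin d → ℂ) → ℂ)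
    (X y : Cn d) (η : Fin d → ℂ) : ℂ :=
  psi φ y (X.2 • realVec η₀) - psiStar φ y η
    + dotProduct (X.1 - y.1) (η - X.2 • realVec η₀)

/-- The set of `(X, y, η')` at which all the terms of the phase are defined. -/
def phaseDomain {d : ℕ} (η₀ : Fin d → ℝ) (U : Set (Cn d × (Fin d → ℂ))) :
    Set (Cn d × Cn d × (Fin d → ℂ)) :=
  {p | (p.2.1, p.1.2 • realVec η₀) ∈ U ∧ (conjCn p.2.1, conjVec p.2.2) ∈ U}

/-- The canonical relation (from the `y`-space to the `X`-space) of a phase `Φ(X, y, η')` with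
fibre variables `η'` and domain `D`:
`{(X, ∂_X Φ ; y, -∂_y Φ) : ∂_{η'} Φ = 0}`. -/
def canonicalRelation {d : ℕ} (D : Set (Cn d × Cn d × (Fin d → ℂ)))
    (Φ : Cn d → Cn d → (Fin d → ℂ) → ℂ) : Set (TCn d × TCn d) :=
  {p | ∃ (X y : Cn d) (η : Fin d → ℂ), (X, y, η) ∈ D ∧ fgrad (fun θ => Φ X y θ) η = 0 ∧
    p = ((X, grad (fun Z => Φ Z y η) X), (y, -grad (fun z => Φ X z η) y))}

/-- The explicit parametrization of the canonical relation by `(y, t, η')`. -/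
def explicitRelation {d : ℕ} (η₀ : Fin d → ℝ) (U : Set (Cn d × (Fin d → ℂ)))
    (φ : Cn d → (Fin d → ℂ) → ℂ) : Set (TCn d × TCn d) :=
  {p | ∃ (y : Cn d) (t : ℂ) (η : Fin d → ℂ),
    (y, t • realVec η₀) ∈ U ∧ (conjCn y, conjVec η) ∈ U ∧
    p = (((y.1 + fgrad (psiStar φ y) η, t),
          (η - t • realVec η₀,
            dotProduct (realVec η₀) (fgrad (psi φ y) (t • realVec η₀))
              - dotProduct (realVec η₀) (fgrad (psiStar φ y) η))),
         (y,
          (-(grad (fun z => psi φ z (t • realVec η₀)) y).1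
              + (grad (fun z => psiStar φ z η) y).1 + η - t • realVec η₀,
            -(grad (fun z => psi φ z (t • realVec η₀)) y).2
              + (grad (fun z => psiStar φ z η) y).2)))}

/-- The canonical complex symplectic form `∑ dy_j^* ∧ dy_j` on `ℂⁿ × ℂⁿ`. -/
def sympl {d : ℕ} (u v : TCn d) : ℂ :=
  (dotProduct u.2.1 v.1.1 + u.2.2 * v.1.2) - (dotProduct v.2.1 u.1.1 + v.2.2 * u.1.2)

/-- The dilation `(y, y^*) ↦ (y, c y^*)`. -/
def dilSource {d : ℕ} (c : ℝ) (ρ : TCn d) : TCn d := (ρ.1, (c : ℂ) • ρ.2)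

/-- The dilation `(x', t, x'^*, t^*) ↦ (x', c t, c x'^*, t^*)`. -/
def dilTarget {d : ℕ} (c : ℝ) (ρ : TCn d) : TCn d :=
  ((ρ.1.1, (c : ℂ) * ρ.1.2), ((c : ℂ) • ρ.2.1, ρ.2.2))

/-- A canonical transformation between open subsets of `ℂⁿ × ℂⁿ`: a biholomorphic map (bijective
from its source onto its target) which preserves the symplectic form. -/
structure IsCanonicalTransformation {d : ℕ} (κ : OpenPartialHomeomorph (TCn d) (TCn d)) :
    Prop where
  holomorphic : DifferentiableOn ℂ κ κ.source
  holomorphic_symm : DifferentiableOn ℂ κ.symm κ.target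
  symplectic : ∀ ρ ∈ κ.source, ∀ u v : TCn d,
    sympl (fderiv ℂ κ ρ u) (fderiv ℂ κ ρ v) = sympl u v

/-- The part over `B × A` of a relation, `A` and `B` being the source and the target of `κ`, is
the graph of `κ : A → B`, written with the value first: `{(κ(ρ), ρ) : ρ ∈ A}`. -/
def IsGraphOf {d : ℕ} (C : Set (TCn d × TCn d)) (κ : OpenPartialHomeomorph (TCn d) (TCn d)) :
    Prop :=
  C ∩ (κ.target ×ˢ κ.source) = {p | p.2 ∈ κ.source ∧ p.1 = κ p.2}

end DNSymbol

end

/-! Set S(y, η, t) = φ(y, tη₀) − φ*(y, η). The terms in y' cancel in the phase, which becomes Φ = S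
+ x'·(η − tη₀). Stationarity in η says x' = −∂_η S, so the critical set is parametrized by p = (y,
η, t), and the canonical relation consists of the pairs (H(p), F(p)) with F = (y, −∂_y S) and H =
(−∂_η S, t; η − tη₀, ∂_t S + η₀·∂_η S). These are `sourceMap` and `targetMap`; the explicit
parametrization is the same set of pairs. Since the Hessian of S is symmetric, F and H pull the
symplectic forms back to the same two-form (`sympl_fderiv_targetMap`), so H ∘ F⁻¹ is canonical
wherever F and H are invertible.

Invertibility at the base point (0; η₀, 1) uses three facts only (`IsConicGenerator`): on y_n = 0, S
equals y'·(tη₀ − η), which gives the mixed tangential Hessian; S is homogeneous of degree one in (η,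
t), so Euler's identity gives the Hessian against the radial vector (0; η₀, 1); and ∂_{y_n} S = i at
the base point, because r(0, η₀) = 1/4 gives ∂_{y_n} φ = i/2 and conjugation reverses its sign in
φ*.

Homogeneity of φ is not assumed, and has to be derived from uniqueness in the Cauchy problem. The
function w = ξ·∂_ξ φ − φ vanishes on y_n = 0 and, by differentiating the squared eikonal equation,
solves a homogeneous linear transport equation with y_n = 0 noncharacteristic near the origin; hence
w = 0 (`eq_zero_of_transport`, `IsHJSolution.euler`), and integrating along rays gives homogeneity.

Homogeneity makes F and H equivariant, so local invertibility spreads over a conic neighbourhood V'.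
V' is taken to be a product in y and (η, t): F determines y and H determines (η, t), so no point of
the relation outside V' can lie over H(V') × F(V'). -/

namespace DNSymbol

open Set Filter Topology Metric

/-! ### Holomorphic functions of several variables: smoothness and the identity theorem. -/

section SeveralComplexVariables

variable {E : Type*} [NormedAddCommGroup E] [NormedSpace ℂ E] {f : E → ℂ} {s : Set E}

theorem hasDerivAt_line {x v : E} {z : ℂ} (hf : DifferentiableAt ℂ f (x + z • v)) :
    HasDerivAt (fun z : ℂ => f (x + z • v)) (fderiv ℂ f (x + z • v) v) z := by
  have h : HasDerivAt (fun z : ℂ => x + z • v) v z := by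
    simpa using ((hasDerivAt_id z).smul_const v).const_add x
  exact hf.hasFDerivAt.comp_hasDerivAt z h

/-- Cauchy's estimate on each complex line through x, using a circle that stays within distance R/2.
It supplies the domination for differentiating under the integral sign below. -/
theorem norm_fderiv_le_of_ball {x : E} {R M : ℝ} (hR : 0 < R) (hM : 0 ≤ M)
    (hf : ∀ z ∈ ball x R, DifferentiableAt ℂ f z) (hb : ∀ z ∈ ball x R, ‖f z‖ ≤ M) :
    ‖fderiv ℂ f x‖ ≤ M / (R / 2) := by
  refine ContinuousLinearMap.opNorm_le_bound _ (by positivity) fun v => ?_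
  rcases eq_or_ne v 0 with rfl | hv
  · simp
  have hv' : 0 < ‖v‖ := norm_pos_iff.2 hv
  set r : ℝ := R / 2 / ‖v‖ with hr
  have hr0 : 0 < r := by positivity
  have hmem : ∀ z ∈ closedBall (0 : ℂ) r, x + z • v ∈ ball x R := by
    intro z hz
    rw [mem_closedBall_zero_iff] at hz
    rw [mem_ball_iff_norm, add_sub_cancel_left, norm_smul]
    calc ‖z‖ * ‖v‖ ≤ r * ‖v‖ := by gcongr
      _ = R / 2 := by rw [hr]; field_simp
      _ < R := by linarith
  have hd : ∀ z ∈ closedBall (0 : ℂ) r,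
      HasDerivAt (fun z : ℂ => f (x + z • v)) (fderiv ℂ f (x + z • v) v) z := fun z hz =>
    hasDerivAt_line (hf _ (hmem z hz))
  have h := Complex.norm_deriv_le_of_forall_mem_sphere_norm_le (f := fun z : ℂ => f (x + z • v))
    (c := 0) hr0
    (DifferentiableOn.diffContOnCl_ball (U := closedBall 0 r)
      (fun z hz => (hd z hz).differentiableAt.differentiableWithinAt) subset_rfl)
    (fun z hz => hb _ (hmem z (sphere_subset_closedBall hz)))
  rw [(hd 0 (mem_closedBall_self hr0.le)).deriv] at h
  simp only [zero_smul, add_zero] at h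
  refine h.trans (le_of_eq ?_)
  rw [hr]; field_simp

open MeasureTheory in
/-- Directional derivatives of a holomorphic function of several variables are holomorphic. -/
theorem differentiableOn_fderiv_apply [FiniteDimensional ℂ E] (hs : IsOpen s)
    (hf : DifferentiableOn ℂ f s) (v : E) : DifferentiableOn ℂ (fun x => fderiv ℂ f x v) s := by
  intro x₀ hx₀
  have hda : ∀ x ∈ s, DifferentiableAt ℂ f x := fun x hx => hf.differentiableAt (hs.mem_nhds hx)
  refine DifferentiableAt.differentiableWithinAt ?_
  rcases eq_or_ne v 0 with rfl | hv
  · simp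
  have hv' : 0 < ‖v‖ := norm_pos_iff.2 hv
  obtain ⟨ρ, hρ, M, hM, hsub, hbd⟩ : ∃ ρ > 0, ∃ M, 0 ≤ M ∧ ball x₀ (3 * ρ) ⊆ s ∧
      ∀ x ∈ ball x₀ (3 * ρ), ‖f x‖ ≤ M := by
    have h1 : ∀ᶠ x in 𝓝 x₀, x ∈ s ∧ ‖f x‖ ≤ ‖f x₀‖ + 1 := by
      refine (show ∀ᶠ x in 𝓝 x₀, x ∈ s from hs.mem_nhds hx₀).and ?_
      have := (hda x₀ hx₀).continuousAt.norm
      exact (this.eventually_lt_const (lt_add_one _)).mono fun x hx => hx.le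
    obtain ⟨ε, hε, h⟩ := Metric.eventually_nhds_iff_ball.1 h1
    refine ⟨ε / 3, by positivity, ‖f x₀‖ + 1, by positivity, ?_, ?_⟩ <;>
      intro x hx <;> rw [mul_div_cancel₀ _ (by norm_num)] at hx
    exacts [(h x hx).1, (h x hx).2]
  set R : ℝ := ρ / ‖v‖ with hR
  have hR0 : 0 < R := by positivity
  have hmem : ∀ x ∈ ball x₀ ρ, ∀ z ∈ closedBall (0 : ℂ) R, x + z • v ∈ ball x₀ (2 * ρ) := by
    intro x hx z hz
    rw [mem_closedBall_zero_iff] at hz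
    rw [mem_ball_iff_norm] at hx ⊢
    calc ‖x + z • v - x₀‖ = ‖(x - x₀) + z • v‖ := by congr 1; abel
      _ ≤ ‖x - x₀‖ + ‖z • v‖ := norm_add_le _ _
      _ = ‖x - x₀‖ + ‖z‖ * ‖v‖ := by rw [norm_smul]
      _ ≤ ‖x - x₀‖ + R * ‖v‖ := by gcongr
      _ = ‖x - x₀‖ + ρ := by rw [hR]; field_simp
      _ < 2 * ρ := by linarith
  have hin : ball x₀ (2 * ρ) ⊆ s := (ball_subset_ball (by linarith)).trans hsub
  have hbound : ∀ x ∈ ball x₀ (2 * ρ), ‖fderiv ℂ f x‖ ≤ M / (ρ / 2) := by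
    intro x hx
    have hb : ball x ρ ⊆ ball x₀ (3 * ρ) := by
      refine ball_subset_ball' ?_
      rw [mem_ball] at hx; linarith
    exact norm_fderiv_le_of_ball hρ hM (fun z hz => hda z (hsub (hb hz))) fun z hz => hbd z (hb hz)
  -- Cauchy's formula on the line x + zv, with a circle independent of x: the directional derivative
  -- is an integral of translates of `f`, to be differentiated in x under the integral sign.
  have hcauchy : ∀ x ∈ ball x₀ ρ, fderiv ℂ f x v = (2 * Real.pi * Complex.I)⁻¹ •
      ∮ z in C(0, R), ((z - 0) ^ 2)⁻¹ • f (x + z • v) := by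
    intro x hx
    have hU : IsOpen {z : ℂ | x + z • v ∈ s} := hs.preimage (by fun_prop)
    rw [Complex.two_pi_I_inv_smul_circleIntegral_sub_sq_inv_smul_of_differentiable hU
      (fun z hz => hin (hmem x hx z hz))
      (fun z hz => (hasDerivAt_line (hda _ hz)).differentiableAt.differentiableWithinAt)
      (mem_ball_self hR0)]
    have := (hasDerivAt_line (f := f) (x := x) (v := v) (z := 0)
      (by simpa using hda x (hin (ball_subset_ball (by linarith) hx)))).deriv
    simpa using this.symm
  have hcm : ∀ θ : ℝ, circleMap 0 R θ ∈ closedBall (0 : ℂ) R := fun θ =>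
    circleMap_mem_closedBall _ hR0.le _
  borelize E
  have key : DifferentiableAt ℂ (fun x => ∫ θ in (0)..(2 * Real.pi),
      deriv (circleMap 0 R) θ • ((circleMap 0 R θ - 0) ^ 2)⁻¹ • f (x + circleMap 0 R θ • v)) x₀ := by
    have hcont : ∀ x ∈ ball x₀ ρ, Continuous fun θ : ℝ =>
        deriv (circleMap 0 R) θ • ((circleMap 0 R θ - 0) ^ 2)⁻¹ • f (x + circleMap 0 R θ • v) := by
      intro x hx
      have h1 : Continuous fun θ : ℝ => f (x + circleMap 0 R θ • v) := by
        refine ContinuousOn.comp_continuous (s := s) hf.continuousOn (by fun_prop)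
          fun θ => hin (hmem x hx _ (hcm θ))
      have h2 : Continuous fun θ : ℝ => ((circleMap 0 R θ - 0) ^ 2)⁻¹ := by
        refine Continuous.inv₀ (by fun_prop) fun θ => ?_
        simp [circleMap_eq_center_iff, hR0.ne']
      have h3 : Continuous (deriv (circleMap 0 R)) := by
        have : deriv (circleMap 0 R) = fun θ => circleMap 0 R θ * Complex.I := by
          ext θ; simp
        rw [this]; fun_prop
      exact h3.smul (h2.smul h1)
    refine (intervalIntegral.hasFDerivAt_integral_of_dominated_of_fderiv_le (𝕜 := ℂ)
      (μ := volume) (s := ball x₀ ρ) (bound := fun _ => R * (R ^ 2)⁻¹ * (M / (ρ / 2)))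
      (F' := fun x θ => deriv (circleMap 0 R) θ • ((circleMap 0 R θ - 0) ^ 2)⁻¹ •
        fderiv ℂ f (x + circleMap 0 R θ • v))
      (ball_mem_nhds _ hρ) ?_ ?_ ?_ ?_ ?_ ?_).differentiableAt
    · filter_upwards [ball_mem_nhds x₀ hρ] with x hx
      exact (hcont x hx).aestronglyMeasurable
    · exact (hcont x₀ (mem_ball_self hρ)).intervalIntegrable _ _
    · refine Measurable.aestronglyMeasurable ?_
      have h1 : Measurable fun θ : ℝ => fderiv ℂ f (x₀ + circleMap 0 R θ • v) :=
        (measurable_fderiv ℂ f).comp (by fun_prop : Continuous fun θ : ℝ =>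
          x₀ + circleMap 0 R θ • v).measurable
      have h2 : Measurable fun θ : ℝ => ((circleMap 0 R θ - 0) ^ 2)⁻¹ :=
        (by fun_prop : Continuous fun θ : ℝ => (circleMap 0 R θ - 0) ^ 2).measurable.inv
      exact Measurable.smul (f := deriv (circleMap 0 R)) (measurable_deriv _) (h2.smul h1)
    · refine Eventually.of_forall fun θ _ x hx => ?_
      have h1 := hbound _ (hmem x hx _ (hcm θ))
      rw [norm_smul, norm_smul, norm_inv, norm_pow, ← mul_assoc]
      have h2 : ‖deriv (circleMap 0 R) θ‖ = R := by simp [abs_of_pos hR0]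
      have h3 : ‖circleMap 0 R θ - 0‖ = R := by simp [abs_of_pos hR0]
      rw [h2, h3]
      gcongr
    · exact intervalIntegrable_const
    · refine Eventually.of_forall fun θ _ x hx => ?_
      have h1 := (hda _ (hin (hmem x hx _ (hcm θ)))).hasFDerivAt
      have h2 : HasFDerivAt (fun y => f (y + circleMap 0 R θ • v))
          (fderiv ℂ f (x + circleMap 0 R θ • v)) x := by
        exact (hasFDerivAt_comp_add_right _).2 h1
      exact (h2.fun_const_smul ((circleMap 0 R θ - 0) ^ 2)⁻¹).fun_const_smul
        (deriv (circleMap 0 R) θ)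
  refine (key.const_smul ((2 * Real.pi * Complex.I : ℂ)⁻¹)).congr_of_eventuallyEq ?_
  filter_upwards [ball_mem_nhds x₀ hρ] with x hx
  rw [hcauchy x hx]; rfl

theorem contDiffOn_of_differentiableOn [FiniteDimensional ℂ E] (hs : IsOpen s)
    (hf : DifferentiableOn ℂ f s) (n : ℕ) : ContDiffOn ℂ n f s := by
  induction n generalizing f with
  | zero => exact contDiffOn_zero.2 hf.continuousOn
  | succ n ih =>
    have h := (contDiffOn_succ_iff_fderiv_of_isOpen (𝕜 := ℂ) (f := f) (n := n) hs).2
      ⟨hf, by simp, contDiffOn_clm_apply.2 fun v => ih (differentiableOn_fderiv_apply hs hf v)⟩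
    exact_mod_cast h

theorem contDiffAt_of_differentiableOn [FiniteDimensional ℂ E] (hs : IsOpen s)
    (hf : DifferentiableOn ℂ f s) {x : E} (hx : x ∈ s) (n : ℕ) : ContDiffAt ℂ n f x :=
  (contDiffOn_of_differentiableOn hs hf n).contDiffAt (hs.mem_nhds hx)

/-- The order of two directional derivatives does not matter. -/
theorem fderiv_fderiv_apply_comm [FiniteDimensional ℂ E] (hs : IsOpen s)
    (hf : DifferentiableOn ℂ f s) {x : E} (hx : x ∈ s) (u v : E) :
    fderiv ℂ (fun z => fderiv ℂ f z v) x u = fderiv ℂ (fun z => fderiv ℂ f z u) x v := by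
  have hc := contDiffAt_of_differentiableOn hs hf hx 2
  have hd : DifferentiableAt ℂ (fderiv ℂ f) x :=
    (hc.fderiv_right (m := 1) (by norm_num)).differentiableAt (by norm_num)
  have h := hc.isSymmSndFDerivAt (by simp [minSmoothness_of_isRCLikeNormedField])
  rw [fderiv_clm_apply hd (by fun_prop), fderiv_clm_apply hd (by fun_prop)]
  simpa using h u v

/-- A holomorphic function on a convex open set that vanishes near a point vanishes identically. -/
theorem eqOn_zero_of_eventuallyEq_zero (hs : IsOpen s) (hc : Convex ℝ s)
    (hf : DifferentiableOn ℂ f s) {x₀ : E} (hx₀ : x₀ ∈ s) (h0 : ∀ᶠ x in 𝓝 x₀, f x = 0)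
    {x : E} (hx : x ∈ s) : f x = 0 := by
  -- The complex line with L 0 = x₀ and L 1 = x. Convexity of `s` makes its preimage connected, so
  -- the one-variable identity theorem carries the vanishing from 0 to 1.
  set L : ℂ → E := fun z => x₀ + z • (x - x₀) with hL
  have hLc : Continuous L := by fun_prop
  have hA : AnalyticOnNhd ℂ (fun z => f (L z)) (L ⁻¹' s) := by
    refine DifferentiableOn.analyticOnNhd (fun z hz => ?_) (hs.preimage hLc)
    exact (hasDerivAt_line (hf.differentiableAt
      (hs.mem_nhds hz))).differentiableAt.differentiableWithinAt
  have hpre : IsPreconnected (L ⁻¹' s) := by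
    refine Convex.isPreconnected ?_
    intro a ha b hb p q hp hq hpq
    have : L (p • a + q • b) = p • L a + q • L b := by
      have hp' : (q : ℝ) = 1 - p := by linarith
      subst hp'
      simp only [hL, ← Complex.coe_smul]
      push_cast
      module
    rw [mem_preimage, this]
    exact hc ha hb hp hq hpq
  have h0' : (fun z => f (L z)) =ᶠ[𝓝 0] 0 := by
    have : Tendsto L (𝓝 0) (𝓝 x₀) := by simpa [hL] using hLc.tendsto 0
    exact this.eventually h0
  have := hA.eqOn_zero_of_preconnected_of_eventuallyEq_zero hpre (z₀ := 0) (by simpa [hL] using hx₀)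
    h0' (x := 1) (by simpa [hL] using hx)
  simpa [hL] using this

end SeveralComplexVariables

/-! ### Uniqueness in the holomorphic Cauchy problem for a transport equation. -/

section Transport

variable {d : ℕ} {Ω : Set (Cn d)} {f g : Cn d → ℂ}

/-- `f` and its first `k` derivatives in the last variable vanish on `Ω ∩ {y_n = 0}`. -/
def VanishesToOrder (Ω : Set (Cn d)) : ℕ → (Cn d → ℂ) → Prop
  | 0, f => ∀ y' : Fin d → ℂ, (y', (0 : ℂ)) ∈ Ω → f (y', 0) = 0
  | k + 1, f => (∀ y' : Fin d → ℂ, (y', (0 : ℂ)) ∈ Ω → f (y', 0) = 0) ∧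
      VanishesToOrder Ω k (fun y => fderiv ℂ f y (0, 1))

namespace VanishesToOrder

theorem of_succ {k : ℕ} (hf : VanishesToOrder Ω (k + 1) f) : VanishesToOrder Ω k f := by
  induction k generalizing f with
  | zero => exact hf.1
  | succ k ih => exact ⟨hf.1, ih hf.2⟩

theorem congr (hΩ : IsOpen Ω) {k : ℕ} (hf : VanishesToOrder Ω k f) (h : EqOn f g Ω) :
    VanishesToOrder Ω k g := by
  induction k generalizing f g with
  | zero => exact fun y' hy => (h hy).symm.trans (hf y' hy)
  | succ k ih =>
    refine ⟨fun y' hy => (h hy).symm.trans (hf.1 y' hy), ih hf.2 fun y hy => ?_⟩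
    have : f =ᶠ[𝓝 y] g := h.eventuallyEq_of_mem (hΩ.mem_nhds hy)
    simp only [this.fderiv_eq]

theorem add (hΩ : IsOpen Ω) {k : ℕ} (hfd : DifferentiableOn ℂ f Ω) (hgd : DifferentiableOn ℂ g Ω)
    (hf : VanishesToOrder Ω k f) (hg : VanishesToOrder Ω k g) :
    VanishesToOrder Ω k (fun y => f y + g y) := by
  induction k generalizing f g with
  | zero => exact fun y' hy => by simp [hf y' hy, hg y' hy]
  | succ k ih =>
    refine ⟨fun y' hy => by simp [hf.1 y' hy, hg.1 y' hy], ?_⟩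
    refine (ih (differentiableOn_fderiv_apply hΩ hfd _) (differentiableOn_fderiv_apply hΩ hgd _)
      hf.2 hg.2).congr hΩ fun y hy => ?_
    have h1 := hfd.differentiableAt (hΩ.mem_nhds hy)
    have h2 := hgd.differentiableAt (hΩ.mem_nhds hy)
    rw [fderiv_fun_add h1 h2]; rfl

theorem zero (Ω : Set (Cn d)) (k : ℕ) : VanishesToOrder Ω k (fun _ => 0) := by
  induction k with
  | zero => exact fun _ _ => rfl
  | succ k ih => exact ⟨fun _ _ => rfl, by simpa using ih⟩

theorem sum (hΩ : IsOpen Ω) {k : ℕ} {ι : Type*} (s : Finset ι) {F : ι → Cn d → ℂ}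
    (hd : ∀ i, DifferentiableOn ℂ (F i) Ω) (hF : ∀ i, VanishesToOrder Ω k (F i)) :
    VanishesToOrder Ω k (fun y => ∑ i ∈ s, F i y) := by
  classical
  induction s using Finset.induction_on with
  | empty => simpa using zero Ω k
  | insert i s hi ih =>
    simp only [Finset.sum_insert hi]
    exact (hF i).add hΩ (hd i) (DifferentiableOn.fun_sum fun j _ => hd j) ih

theorem mul (hΩ : IsOpen Ω) {k : ℕ} (hgd : DifferentiableOn ℂ g Ω) (hfd : DifferentiableOn ℂ f Ω)
    (hf : VanishesToOrder Ω k f) : VanishesToOrder Ω k (fun y => g y * f y) := by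
  induction k generalizing f g with
  | zero => exact fun y' hy => by simp [hf y' hy]
  | succ k ih =>
    refine ⟨fun y' hy => by simp [hf.1 y' hy], ?_⟩
    have hf' := differentiableOn_fderiv_apply hΩ hfd (0, 1)
    have hg' := differentiableOn_fderiv_apply hΩ hgd (0, 1)
    refine ((ih hgd hf' hf.2).add hΩ (hgd.mul hf') (hg'.mul hfd)
      (ih hg' hfd hf.of_succ)).congr hΩ fun y hy => ?_
    have h1 := hfd.differentiableAt (hΩ.mem_nhds hy)
    have h2 := hgd.differentiableAt (hΩ.mem_nhds hy)
    rw [fderiv_fun_mul h2 h1]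
    simp [mul_comm]

/-- A line in direction (v, 0) stays in the hyperplane y_n = 0, which settles order zero; commuting
the tangential with the normal derivative gives the higher orders. -/
theorem tangential (hΩ : IsOpen Ω) {k : ℕ} (hfd : DifferentiableOn ℂ f Ω)
    (hf : VanishesToOrder Ω k f) (v : Fin d → ℂ) :
    VanishesToOrder Ω k (fun y => fderiv ℂ f y (v, 0)) := by
  have hbase : ∀ {f : Cn d → ℂ}, DifferentiableOn ℂ f Ω →
      (∀ y' : Fin d → ℂ, (y', (0 : ℂ)) ∈ Ω → f (y', 0) = 0) →
      ∀ y' : Fin d → ℂ, (y', (0 : ℂ)) ∈ Ω → fderiv ℂ f (y', 0) (v, 0) = 0 := by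
    intro f hfd hf y' hy
    have h1 := hasDerivAt_line (f := f) (x := (y', 0)) (v := (v, 0)) (z := 0)
      (by simpa using hfd.differentiableAt (hΩ.mem_nhds hy))
    have h2 : (fun z : ℂ => f ((y', 0) + z • (v, 0))) =ᶠ[𝓝 0] fun _ => 0 := by
      have hc : Continuous fun z : ℂ => ((y', 0) : Cn d) + z • (v, 0) := by fun_prop
      have := hc.tendsto 0
      simp only [zero_smul, add_zero] at this
      filter_upwards [this (hΩ.mem_nhds hy)] with z hz
      have e : ((y', 0) : Cn d) + z • (v, 0) = (y' + z • v, 0) := by ext <;> simp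
      rw [mem_preimage, e] at hz
      rw [e, hf _ hz]
    have h3 := h1.congr_of_eventuallyEq h2.symm
    simpa using h3.unique (hasDerivAt_const _ _)
  induction k generalizing f with
  | zero => exact hbase hfd hf
  | succ k ih =>
    refine ⟨hbase hfd hf.1, (ih (differentiableOn_fderiv_apply hΩ hfd _) hf.2).congr hΩ
      fun y hy => fderiv_fderiv_apply_comm hΩ hfd hy _ _⟩

theorem iteratedDeriv_eq_zero (hΩ : IsOpen Ω) {k : ℕ} (hfd : DifferentiableOn ℂ f Ω)
    (hf : VanishesToOrder Ω k f) (y' : Fin d → ℂ) (hy : (y', (0 : ℂ)) ∈ Ω) :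
    iteratedDeriv k (fun z : ℂ => f (y', z)) 0 = 0 := by
  induction k generalizing f with
  | zero => simpa using hf y' hy
  | succ k ih =>
    rw [iteratedDeriv_succ']
    have key : deriv (fun z : ℂ => f (y', z)) =ᶠ[𝓝 0] fun z => fderiv ℂ f (y', z) (0, 1) := by
      have hc : Continuous fun z : ℂ => ((y', z) : Cn d) := by fun_prop
      filter_upwards [hc.tendsto 0 (hΩ.mem_nhds hy)] with z hz
      have h1 := hasDerivAt_line (f := f) (x := ((y', 0) : Cn d)) (v := (0, 1)) (z := z)
        (by simpa using hfd.differentiableAt (hΩ.mem_nhds hz))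
      simpa using h1.deriv
    exact (key.iteratedDeriv_eq k).trans (ih (differentiableOn_fderiv_apply hΩ hfd _) hf.2)

end VanishesToOrder

theorem eventuallyEq_zero_of_iteratedDeriv {h : ℂ → ℂ} {z : ℂ} (hh : AnalyticAt ℂ h z)
    (h0 : ∀ k, iteratedDeriv k h z = 0) : ∀ᶠ x in 𝓝 z, h x = 0 := by
  have := hh.hasFPowerSeriesAt
  simp only [h0, zero_div] at this
  have e : FormalMultilinearSeries.ofScalars ℂ (fun _ => (0 : ℂ)) =
      (0 : FormalMultilinearSeries ℂ ℂ ℂ) := by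
    ext n
    simp [FormalMultilinearSeries.ofScalars]
  rw [e] at this
  exact this.eventually_eq_zero

/-- Uniqueness in the noncharacteristic holomorphic Cauchy problem for a homogeneous first order
linear equation. -/
theorem eq_zero_of_transport {Y : Set (Cn d)} (hY : IsOpen Y) (hYc : Convex ℝ Y)
    (h0 : (0 : Cn d) ∈ Y) {w b : Cn d → ℂ} {a : Fin d → Cn d → ℂ} (hw : DifferentiableOn ℂ w Y)
    (hb : DifferentiableOn ℂ b Y) (ha : ∀ j, DifferentiableOn ℂ (a j) Y) (hb0 : b 0 ≠ 0)
    (heq : ∀ y ∈ Y, b y * fderiv ℂ w y (0, 1) = ∑ j, a j y * fderiv ℂ w y (Pi.single j 1, 0))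
    (hinit : ∀ y' : Fin d → ℂ, (y', (0 : ℂ)) ∈ Y → w (y', 0) = 0) :
    ∀ y ∈ Y, w y = 0 := by
  have hbc : ContinuousAt b 0 := (hb.differentiableAt (hY.mem_nhds h0)).continuousAt
  obtain ⟨ε, hε, hball⟩ := Metric.eventually_nhds_iff_ball.1
    ((show ∀ᶠ y in 𝓝 (0 : Cn d), y ∈ Y from hY.mem_nhds h0).and (hbc.eventually_ne hb0))
  set Ω : Set (Cn d) := ball 0 ε with hΩdef
  have hΩ : IsOpen Ω := isOpen_ball
  have hΩY : Ω ⊆ Y := fun y hy => (hball y hy).1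
  have hwΩ := hw.mono hΩY
  have hvan : ∀ k, VanishesToOrder Ω k w := by
    intro k
    induction k with
    | zero => exact fun y' hy => hinit y' (hΩY hy)
    | succ k ih =>
      refine ⟨fun y' hy => hinit y' (hΩY hy), ?_⟩
      -- Dividing by `b` expresses the normal derivative of `w` through tangential ones. These
      -- vanish to order k by induction, so `w` vanishes to order k + 1.
      have hbinv : DifferentiableOn ℂ (fun y => (b y)⁻¹) Ω :=
        (hb.mono hΩY).inv fun y hy => (hball y hy).2
      have hd : ∀ j : Fin d, DifferentiableOn ℂ
          (fun y => fderiv ℂ w y (Pi.single j 1, 0)) Ω := fun j =>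
        differentiableOn_fderiv_apply hΩ hwΩ _
      refine ((VanishesToOrder.sum hΩ Finset.univ (fun j => ((ha j).mono hΩY).mul (hd j))
        fun j => (ih.tangential hΩ hwΩ _).mul hΩ ((ha j).mono hΩY) (hd j)).mul hΩ hbinv
          (DifferentiableOn.fun_sum fun j _ => ((ha j).mono hΩY).mul (hd j))).congr hΩ
        fun y hy => ?_
      have := heq y (hΩY hy)
      rw [inv_mul_eq_iff_eq_mul₀ (hball y hy).2]
      exact this.symm
  have hzero : ∀ y ∈ Ω, w y = 0 := by
    -- The ball is a product for the max norm, so each slice in the normal variable is a disc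
    -- centred on y_n = 0, where all Taylor coefficients vanish.
    rintro ⟨y', z⟩ hy
    have hmem : ∀ x : ℂ, ((y', x) : Cn d) ∈ Ω ↔ ‖y'‖ < ε ∧ x ∈ ball (0 : ℂ) ε := by
      intro x; simp [hΩdef, Prod.norm_def]
    have hy' := (hmem z).1 hy
    have hd : DifferentiableOn ℂ (fun x : ℂ => w (y', x)) (ball 0 ε) := by
      intro x hx
      have h1 := hwΩ.differentiableAt (hΩ.mem_nhds ((hmem x).2 ⟨hy'.1, hx⟩))
      exact (h1.comp x (f := fun x : ℂ => ((y', x) : Cn d))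
        (by fun_prop)).differentiableWithinAt
    have han : AnalyticAt ℂ (fun x : ℂ => w (y', x)) 0 :=
      hd.analyticAt (ball_mem_nhds _ hε)
    refine eqOn_zero_of_eventuallyEq_zero isOpen_ball (convex_ball _ _) hd (mem_ball_self hε)
      (eventuallyEq_zero_of_iteratedDeriv han fun k => ?_) hy'.2
    exact (hvan k).iteratedDeriv_eq_zero hΩ hwΩ y' ((hmem 0).2 ⟨hy'.1, mem_ball_self hε⟩)
  intro y hy
  exact eqOn_zero_of_eventuallyEq_zero hY hYc hw h0
    (eventually_of_mem (ball_mem_nhds _ hε) hzero) hy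

end Transport

/-! ### The Hamilton–Jacobi equation and homogeneity of its solution. -/

section HamiltonJacobi

variable {d : ℕ} {η₀ : Fin d → ℝ} {W : Set (Cn d)} {G : Cn d → Matrix (Fin d) (Fin d) ℂ}
  {U : Set (Cn d × (Fin d → ℂ))} {φ : Cn d → (Fin d → ℂ) → ℂ}

theorem symbol_smul (y : Cn d) (c : ℂ) (ξ : Fin d → ℂ) :
    symbol G y (c • ξ) = c ^ 2 * symbol G y ξ := by
  simp only [symbol, Finset.mul_sum, Pi.smul_apply, smul_eq_mul]
  exact Finset.sum_congr rfl fun j _ => Finset.sum_congr rfl fun k _ => by ring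

theorem continuous_symbol (y : Cn d) : Continuous (symbol G y) := by
  unfold symbol; fun_prop

namespace IsHJSolution

variable (hφ : IsHJSolution W G η₀ U φ)
include hφ

theorem differentiableAt {p : Cn d × (Fin d → ℂ)} (hp : p ∈ U) :
    DifferentiableAt ℂ (fun p : Cn d × (Fin d → ℂ) => φ p.1 p.2) p :=
  hφ.holomorphic.differentiableAt (hφ.isOpen.mem_nhds hp)

theorem fderiv_base {y : Cn d} {ξ : Fin d → ℂ} (hp : (y, ξ) ∈ U) (e : Cn d) :
    fderiv ℂ (fun z => φ z ξ) y e =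
      fderiv ℂ (fun p : Cn d × (Fin d → ℂ) => φ p.1 p.2) (y, ξ) (e, 0) := by
  have h : HasFDerivAt (fun z : Cn d => (z, ξ)) (ContinuousLinearMap.inl ℂ (Cn d) (Fin d → ℂ)) y :=
    hasFDerivAt_prodMk_left y ξ
  have := ((hφ.differentiableAt hp).hasFDerivAt.comp y h).fderiv
  have h2 : fderiv ℂ (fun z => φ z ξ) y = _ := this
  rw [h2]; rfl

/-- The direction is tangent to y_n = 0, so only the initial data y'·ξ, restricted to a line,
enters. -/
theorem fderiv_initial {y' ξ : Fin d → ℂ} (hp : ((y', (0 : ℂ)), ξ) ∈ U) (v ζ : Fin d → ℂ) :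
    fderiv ℂ (fun p : Cn d × (Fin d → ℂ) => φ p.1 p.2) ((y', 0), ξ) ((v, 0), ζ) =
      dotProduct v ξ + dotProduct y' ζ := by
  have h1 := hasDerivAt_line (f := fun p : Cn d × (Fin d → ℂ) => φ p.1 p.2)
    (x := ((y', 0), ξ)) (v := ((v, 0), ζ)) (z := 0) (by simpa using hφ.differentiableAt hp)
  simp only [zero_smul, add_zero] at h1
  have h2 : (fun z : ℂ => φ (y' + z • v, 0) (ξ + z • ζ)) =ᶠ[𝓝 0]
      fun z => dotProduct (y' + z • v) (ξ + z • ζ) := by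
    have hc : Continuous fun z : ℂ => (((y' + z • v, 0), ξ + z • ζ) : Cn d × (Fin d → ℂ)) := by
      fun_prop
    have := hc.tendsto 0
    simp only [zero_smul, add_zero] at this
    filter_upwards [this (hφ.isOpen.mem_nhds hp)] with z hz using hφ.initial _ _ hz
  have h3 : HasDerivAt (fun z : ℂ => dotProduct (y' + z • v) (ξ + z • ζ))
      (dotProduct v ξ + dotProduct y' ζ) 0 := by
    have e : (fun z : ℂ => dotProduct (y' + z • v) (ξ + z • ζ)) = fun z =>
        dotProduct y' ξ + z * (dotProduct v ξ + dotProduct y' ζ) + z ^ 2 * dotProduct v ζ := by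
      ext z
      simp only [add_dotProduct, dotProduct_add, smul_dotProduct, dotProduct_smul, smul_eq_mul]
      ring
    rw [e]
    have := (((hasDerivAt_id (0 : ℂ)).mul_const (dotProduct v ξ + dotProduct y' ζ)).const_add
      (dotProduct y' ξ)).fun_add ((hasDerivAt_pow 2 (0 : ℂ)).mul_const (dotProduct v ζ))
    simpa using this
  have h4 := h3.congr_of_eventuallyEq h2
  refine HasDerivAt.unique ?_ h4
  simpa using h1

/-- Squaring removes the branch of the root: what is differentiated later is polynomial in the
derivatives of φ. -/
theorem sq_eikonal {y : Cn d} {ξ : Fin d → ℂ} (hp : (y, ξ) ∈ U) :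
    (fderiv ℂ (fun p : Cn d × (Fin d → ℂ) => φ p.1 p.2) (y, ξ) ((0, 1), 0)) ^ 2 =
      -symbol G y (fun j =>
        fderiv ℂ (fun p : Cn d × (Fin d → ℂ) => φ p.1 p.2) (y, ξ) ((Pi.single j 1, 0), 0)) := by
  have h := hφ.eikonal y ξ hp
  simp only [grad, hφ.fderiv_base hp] at h
  rw [h, mul_pow, Complex.I_sq]
  have : ∀ x : ℂ, (x ^ (1 / 2 : ℂ)) ^ 2 = x := fun x => by
    simp
  rw [this]; ring

/-- Differentiate the squared eikonal equation along ξ, and subtract twice the equation itself,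
which is quadratic in ∂_y φ. What remains is a homogeneous linear transport equation for w = ξ·∂_ξ φ
− φ, and w vanishes initially. -/
theorem euler {Y : Set (Cn d)} (hY : IsOpen Y) (hYc : Convex ℝ Y) (h0 : (0 : Cn d) ∈ Y)
    (hG : ∀ j k, DifferentiableOn ℂ (fun y => G y j k) Y) {ξ : Fin d → ℂ}
    (hU : ∀ y ∈ Y, (y, ξ) ∈ U) (hξ : symbol G 0 ξ ≠ 0) {y : Cn d} (hy : y ∈ Y) :
    fderiv ℂ (fun p : Cn d × (Fin d → ℂ) => φ p.1 p.2) (y, ξ) (0, ξ) = φ y ξ := by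
  set Φ : Cn d × (Fin d → ℂ) → ℂ := fun p => φ p.1 p.2 with hΦ
  set D : Cn d → Cn d × (Fin d → ℂ) → ℂ := fun e p => fderiv ℂ Φ p (e, 0) with hD
  have hDd : ∀ e, DifferentiableOn ℂ (D e) U := fun e =>
    differentiableOn_fderiv_apply hφ.isOpen hφ.holomorphic _
  have hEd : DifferentiableOn ℂ (fun p => fderiv ℂ Φ p (0, ξ)) U :=
    differentiableOn_fderiv_apply hφ.isOpen hφ.holomorphic _
  have hsl : ∀ {g : Cn d × (Fin d → ℂ) → ℂ}, DifferentiableOn ℂ g U → ∀ z ∈ Y,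
      HasFDerivAt (fun z => g (z, ξ))
        ((fderiv ℂ g (z, ξ)).comp (ContinuousLinearMap.inl ℂ (Cn d) (Fin d → ℂ))) z := by
    intro g hg z hz
    exact (hg.differentiableAt (hφ.isOpen.mem_nhds (hU z hz))).hasFDerivAt.comp z
      (hasFDerivAt_prodMk_left z ξ)
  have hsl' : ∀ {g : Cn d × (Fin d → ℂ) → ℂ}, DifferentiableOn ℂ g U →
      DifferentiableOn ℂ (fun z => g (z, ξ)) Y := fun hg z hz =>
    (hsl hg z hz).differentiableAt.differentiableWithinAt
  set w : Cn d → ℂ := fun z => fderiv ℂ Φ (z, ξ) (0, ξ) - Φ (z, ξ) with hw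
  have hwd : ∀ z ∈ Y, ∀ e, fderiv ℂ w z e = fderiv ℂ (D e) (z, ξ) (0, ξ) - D e (z, ξ) := by
    intro z hz e
    rw [show fderiv ℂ w z = _ from ((hsl hEd z hz).fun_sub (hsl hφ.holomorphic z hz)).fderiv]
    have := fderiv_fderiv_apply_comm hφ.isOpen hφ.holomorphic (hU z hz) (e, 0) (0, ξ)
    simp [hD, hΦ, this]
  have hdiff : ∀ z ∈ Y, 2 * D (0, 1) (z, ξ) * fderiv ℂ (D (0, 1)) (z, ξ) (0, ξ) =
      -∑ j, ∑ k, G z j k *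
        (fderiv ℂ (D (Pi.single j 1, 0)) (z, ξ) (0, ξ) * D (Pi.single k 1, 0) (z, ξ) +
        D (Pi.single j 1, 0) (z, ξ) * fderiv ℂ (D (Pi.single k 1, 0)) (z, ξ) (0, ξ)) := by
    intro z hz
    have hl : ∀ e, HasDerivAt (fun t : ℂ => D e (z, ξ + t • ξ))
        (fderiv ℂ (D e) (z, ξ) (0, ξ)) 0 := by
      intro e
      have := hasDerivAt_line (f := D e) (x := (z, ξ)) (v := (0, ξ)) (z := 0)
        (by simpa using (hDd e).differentiableAt (hφ.isOpen.mem_nhds (hU z hz)))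
      simpa using this
    have h1 := (hl (0, 1)).fun_pow 2
    have h2 : HasDerivAt (fun t : ℂ => -symbol G z fun j => D (Pi.single j 1, 0) (z, ξ + t • ξ))
        (-∑ j, ∑ k, G z j k *
        (fderiv ℂ (D (Pi.single j 1, 0)) (z, ξ) (0, ξ) * D (Pi.single k 1, 0) (z, ξ) +
        D (Pi.single j 1, 0) (z, ξ) * fderiv ℂ (D (Pi.single k 1, 0)) (z, ξ) (0, ξ))) 0 := by
      unfold symbol
      refine HasDerivAt.fun_neg (HasDerivAt.fun_sum fun j _ => HasDerivAt.fun_sum fun k _ => ?_)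
      have := ((hl (Pi.single j 1, 0)).fun_mul (hl (Pi.single k 1, 0))).const_mul (G z j k)
      simpa [mul_assoc] using this
    have hev : (fun t : ℂ => D (0, 1) (z, ξ + t • ξ) ^ 2) =ᶠ[𝓝 0]
        fun t => -symbol G z fun j => D (Pi.single j 1, 0) (z, ξ + t • ξ) := by
      have hc : Continuous fun t : ℂ => ((z, ξ + t • ξ) : Cn d × (Fin d → ℂ)) := by fun_prop
      have := hc.tendsto 0
      simp only [zero_smul, add_zero] at this
      filter_upwards [this (hφ.isOpen.mem_nhds (hU z hz))] with t ht using hφ.sq_eikonal ht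
    have := h1.unique (h2.congr_of_eventuallyEq hev)
    simpa using this
  have hzero := eq_zero_of_transport hY hYc h0 (w := w)
    (b := fun z => 2 * D (0, 1) (z, ξ))
    (a := fun j z => -∑ k, (G z j k + G z k j) * D (Pi.single k 1, 0) (z, ξ))
    ((hsl' hEd).sub (hsl' hφ.holomorphic)) ((hsl' (hDd _)).const_mul 2)
    (fun j => (DifferentiableOn.fun_sum fun k _ =>
      ((hG j k).add (hG k j)).mul (hsl' (hDd _))).neg) ?_ ?_ ?_ y hy
  · exact sub_eq_zero.1 hzero
  -- Noncharacteristic at the origin: there (∂_{y_n} φ)² = −r(0, ξ) ≠ 0.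
  · intro h
    have h1 : D (0, 1) (0, ξ) = 0 := by simpa using h
    have h2 := hφ.sq_eikonal (hU 0 h0)
    change D (0, 1) (0, ξ) ^ 2 = _ at h2
    rw [h1] at h2
    have h3 : (fun j => fderiv ℂ (fun p : Cn d × (Fin d → ℂ) => φ p.1 p.2) (0, ξ)
        ((Pi.single j 1, 0), 0)) = ξ := by
      ext j
      have := hφ.fderiv_initial (y' := 0) (ξ := ξ) (hU 0 h0) (Pi.single j 1) 0
      simp only [single_one_dotProduct, dotProduct_zero, add_zero] at this
      exact this
    rw [h3] at h2
    apply hξ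
    simpa using h2
  · intro z hz
    have h1 := hdiff z hz
    have h2 := hφ.sq_eikonal (hU z hz)
    change D (0, 1) (z, ξ) ^ 2 = -symbol G z fun j => D (Pi.single j 1, 0) (z, ξ) at h2
    rw [hwd z hz]
    simp only [hwd z hz]
    have h3 : ∑ j, ∑ k, G z k j * D (Pi.single k 1, 0) (z, ξ) *
          fderiv ℂ (D (Pi.single j 1, 0)) (z, ξ) (0, ξ) =
        ∑ j, ∑ k, G z j k * D (Pi.single j 1, 0) (z, ξ) *
          fderiv ℂ (D (Pi.single k 1, 0)) (z, ξ) (0, ξ) := Finset.sum_comm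
    have h4 : ∑ j, ∑ k, G z k j * D (Pi.single k 1, 0) (z, ξ) * D (Pi.single j 1, 0) (z, ξ) =
        ∑ j, ∑ k, G z j k * D (Pi.single j 1, 0) (z, ξ) * D (Pi.single k 1, 0) (z, ξ) :=
      Finset.sum_comm
    unfold symbol at h2
    -- The coefficients carry G_{jk} + G_{kj}, so exchanging the summation indices suffices and
    -- symmetry of `G` never enters.
    have h5 : ∑ j, (-∑ k, (G z j k + G z k j) * D (Pi.single k 1, 0) (z, ξ)) *
          (fderiv ℂ (D (Pi.single j 1, 0)) (z, ξ) (0, ξ) - D (Pi.single j 1, 0) (z, ξ)) =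
        -∑ j, ∑ k, G z j k *
          (fderiv ℂ (D (Pi.single j 1, 0)) (z, ξ) (0, ξ) * D (Pi.single k 1, 0) (z, ξ) +
          D (Pi.single j 1, 0) (z, ξ) * fderiv ℂ (D (Pi.single k 1, 0)) (z, ξ) (0, ξ)) +
        2 * ∑ j, ∑ k, G z j k * D (Pi.single j 1, 0) (z, ξ) * D (Pi.single k 1, 0) (z, ξ) := by
      have e1 : ∀ j k, G z j k *
          (fderiv ℂ (D (Pi.single j 1, 0)) (z, ξ) (0, ξ) * D (Pi.single k 1, 0) (z, ξ) +
          D (Pi.single j 1, 0) (z, ξ) * fderiv ℂ (D (Pi.single k 1, 0)) (z, ξ) (0, ξ)) =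
          G z j k * D (Pi.single k 1, 0) (z, ξ) * fderiv ℂ (D (Pi.single j 1, 0)) (z, ξ) (0, ξ) +
          G z j k * D (Pi.single j 1, 0) (z, ξ) *
            fderiv ℂ (D (Pi.single k 1, 0)) (z, ξ) (0, ξ) := fun j k => by ring
      simp only [e1, Finset.sum_add_distrib]
      rw [← h3, two_mul]
      nth_rewrite 1 [← h4]
      simp only [← Finset.sum_add_distrib, ← Finset.sum_neg_distrib, Finset.sum_mul]
      refine Finset.sum_congr rfl fun j _ => Finset.sum_congr rfl fun k _ => by ring
    rw [h5, ← h1]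
    linear_combination -2 * h2
  · intro y' hy'
    have h1 := hφ.fderiv_initial (hU _ hy') 0 ξ
    have h2 := hφ.initial y' ξ (hU _ hy')
    simp only [zero_dotProduct, zero_add] at h1
    simp only [hw, hΦ]
    rw [h2, ← h1, sub_eq_zero]
    rfl

/-- The solution of the Hamilton-Jacobi problem is positively homogeneous of degree one. -/
theorem homogeneous (hG : IsEllipticSymbol W G) (hη₀ : symbol G 0 (realVec η₀) = 1 / 4) :
    ∃ ε > 0, ∀ y ∈ ball (0 : Cn d) ε, ∀ ξ ∈ ball (realVec η₀) ε, ∀ c : ℝ, 0 < c →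
      (y, (c : ℂ) • ξ) ∈ U ∧ φ y ((c : ℂ) • ξ) = c * φ y ξ := by
  have h1 : ∀ᶠ p : Cn d × (Fin d → ℂ) in 𝓝 (0, realVec η₀), p ∈ U ∧ symbol G 0 p.2 ≠ 0 := by
    refine (show ∀ᶠ p in 𝓝 (0, realVec η₀), p ∈ U from hφ.isOpen.mem_nhds hφ.base_mem).and ?_
    refine ContinuousAt.eventually_ne ?_ ?_
    · exact ((continuous_symbol 0).comp continuous_snd).continuousAt
    · simp [hη₀]
  obtain ⟨ε, hε, h⟩ := Metric.eventually_nhds_iff_ball.1 h1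
  have hmem : ∀ y ∈ ball (0 : Cn d) ε, ∀ ξ ∈ ball (realVec η₀) ε,
      (y, ξ) ∈ U ∧ symbol G 0 ξ ≠ 0 := fun y hy ξ hξ =>
    h (y, ξ) (by rw [← ball_prod_same]; exact ⟨hy, hξ⟩)
  have hmemc : ∀ y ∈ ball (0 : Cn d) ε, ∀ ξ ∈ ball (realVec η₀) ε, ∀ c : ℝ, 0 < c →
      (y, (c : ℂ) • ξ) ∈ U := fun y hy ξ hξ c hc => hφ.conic _ _ (hmem y hy ξ hξ).1 c hc
  refine ⟨ε, hε, fun y hy ξ hξ c hc => ⟨hmemc y hy ξ hξ c hc, ?_⟩⟩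
  -- Euler's identity makes t⁻¹ φ(y, tξ) constant in t > 0; homogeneity is then the comparison of t
  -- = c with t = 1.
  have hder : ∀ t ∈ Ioi (0 : ℝ),
      HasDerivAt (fun t : ℝ => ((t : ℂ))⁻¹ * φ y ((t : ℂ) • ξ)) 0 t := by
    intro t ht
    have ht' : (t : ℂ) ≠ 0 := by exact_mod_cast (ne_of_gt ht)
    -- Euler's identity is needed at tξ for every t > 0. Conicity of `U` keeps the whole ball in y
    -- available as the convex domain there.
    have hE := hφ.euler (Y := ball 0 ε) isOpen_ball (convex_ball _ _) (mem_ball_self hε)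
      (fun j k => (hG.holomorphic j k).mono fun z hz => hφ.subset z ξ (hmem z hz ξ hξ).1)
      (ξ := (t : ℂ) • ξ) (fun z hz => hmemc z hz ξ hξ t ht)
      (by
        rw [symbol_smul]
        exact mul_ne_zero (pow_ne_zero _ ht') (hmem y hy ξ hξ).2) hy
    have hl := hasDerivAt_line (f := fun p : Cn d × (Fin d → ℂ) => φ p.1 p.2)
      (x := (y, 0)) (v := (0, ξ)) (z := (t : ℂ))
      (by simpa using hφ.differentiableAt (hmemc y hy ξ hξ t ht))
    simp only [Prod.smul_mk, smul_zero, Prod.mk_add_mk, add_zero, zero_add] at hl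
    have hsc : fderiv ℂ (fun p : Cn d × (Fin d → ℂ) => φ p.1 p.2) (y, (t : ℂ) • ξ)
        (0, (t : ℂ) • ξ) = t * fderiv ℂ (fun p : Cn d × (Fin d → ℂ) => φ p.1 p.2)
          (y, (t : ℂ) • ξ) (0, ξ) := by
      rw [← smul_eq_mul, ← map_smul]; simp
    have h2 := ((hasDerivAt_inv ht').fun_mul hl).comp_ofReal
    convert h2 using 1
    rw [← hE, hsc]
    field_simp
    ring
  have hconst := (isOpen_Ioi (a := (0 : ℝ))).is_const_of_deriv_eq_zero
    (isPreconnected_Ioi) (fun t ht => (hder t ht).differentiableAt.differentiableWithinAt)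
    (fun t ht => (hder t ht).deriv) (show c ∈ Ioi (0 : ℝ) from hc)
    (show (1 : ℝ) ∈ Ioi (0 : ℝ) from mem_Ioi.2 one_pos)
  have hc' : (c : ℂ) ≠ 0 := by exact_mod_cast hc.ne'
  simp only [Complex.ofReal_one, inv_one, one_smul, one_mul] at hconst
  rw [← hconst, mul_inv_cancel_left₀ hc']

end IsHJSolution

end HamiltonJacobi

/-! ### The two maps of a generating function and the symplectic form. -/

section GeneratingFunction

variable {d : ℕ}

/-- The map `(y, η, t) ↦ (y, -∂_y S)`. -/
noncomputable def sourceMap (S : TCn d → ℂ) (p : TCn d) : TCn d :=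
  (p.1, (fun j => -fderiv ℂ S p ((Pi.single j 1, 0), 0), -fderiv ℂ S p ((0, 1), 0)))

/-- The map `(y, η, t) ↦ (-∂_η S, t; η - t e, ∂_t S + e · ∂_η S)`. -/
noncomputable def targetMap (e : Fin d → ℂ) (S : TCn d → ℂ) (p : TCn d) : TCn d :=
  ((fun j => -fderiv ℂ S p (0, (Pi.single j 1, 0)), p.2.2),
    (p.2.1 - p.2.2 • e, fderiv ℂ S p (0, (e, 1))))

theorem pi_sum_single (v : Fin d → ℂ) : v = ∑ j, v j • (Pi.single j 1 : Fin d → ℂ) := by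
  ext k
  simp [Finset.sum_apply, Pi.single_apply]

theorem clm_TCn_apply (L : TCn d →L[ℂ] ℂ) (v : TCn d) :
    L v = dotProduct (fun j => L ((Pi.single j 1, 0), 0)) v.1.1 + L ((0, 1), 0) * v.1.2 +
      dotProduct (fun j => L (0, (Pi.single j 1, 0))) v.2.1 + L (0, (0, 1)) * v.2.2 := by
  obtain ⟨⟨a, b⟩, ⟨c, t⟩⟩ := v
  have h : (((a, b), (c, t)) : TCn d) = (∑ j, a j • ((Pi.single j 1, 0), 0)) + b • ((0, 1), 0) +
      (∑ j, c j • (0, (Pi.single j 1, 0))) + t • (0, (0, 1)) := by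
    refine Prod.ext (Prod.ext ?_ ?_) (Prod.ext ?_ ?_)
    · simpa [Prod.fst_sum, Prod.snd_sum] using pi_sum_single a
    · simp [Prod.fst_sum, Prod.snd_sum]
    · simpa [Prod.fst_sum, Prod.snd_sum] using pi_sum_single c
    · simp [Prod.snd_sum]
  rw [h]
  simp only [map_add, map_sum, map_smul, smul_eq_mul, dotProduct]
  congr 1
  · congr 1
    · congr 1
      · simp [mul_comm, Prod.fst_sum, Finset.sum_apply, Pi.single_apply]
      · simp [mul_comm, Prod.fst_sum, Prod.snd_sum]
    · simp [mul_comm, Prod.fst_sum, Prod.snd_sum, Finset.sum_apply, Pi.single_apply]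
  · simp [mul_comm, Prod.snd_sum]

theorem clm_TCn_apply_snd (L : TCn d →L[ℂ] ℂ) (ζ : Fin d → ℂ) (τ : ℂ) :
    L (0, (ζ, τ)) = dotProduct (fun j => L (0, (Pi.single j 1, 0))) ζ + τ * L (0, (0, 1)) := by
  rw [clm_TCn_apply L (0, (ζ, τ))]
  simp [mul_comm]

variable {Ω : Set (TCn d)} {S : TCn d → ℂ} (hΩ : IsOpen Ω) (hS : DifferentiableOn ℂ S Ω)
  {p : TCn d} (hp : p ∈ Ω) (e : Fin d → ℂ)
include hΩ hS hp

theorem contDiffAt_fderiv_apply (v : TCn d) (n : ℕ) :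
    ContDiffAt ℂ n (fun z => fderiv ℂ S z v) p :=
  contDiffAt_of_differentiableOn hΩ (differentiableOn_fderiv_apply hΩ hS v) hp n

theorem contDiffAt_sourceMap (n : ℕ) : ContDiffAt ℂ n (sourceMap S) p := by
  have h := fun v => contDiffAt_fderiv_apply hΩ hS hp v n
  exact contDiffAt_fst.prodMk ((contDiffAt_pi.2 fun j => (h _).neg).prodMk (h _).neg)

theorem contDiffAt_targetMap (n : ℕ) : ContDiffAt ℂ n (targetMap e S) p := by
  have h := fun v => contDiffAt_fderiv_apply hΩ hS hp v n
  exact ((contDiffAt_pi.2 fun j => (h _).neg).prodMk (by fun_prop)).prodMk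
    (ContDiffAt.prodMk (by fun_prop) (h _))

theorem hasFDerivAt_fderiv_apply (v : TCn d) :
    HasFDerivAt (fun z => fderiv ℂ S z v) ((fderiv ℂ (fderiv ℂ S) p).flip v) p := by
  have hd : DifferentiableAt ℂ (fderiv ℂ S) p :=
    ((contDiffAt_of_differentiableOn hΩ hS hp 2).fderiv_right (m := 1)
      (by norm_num)).differentiableAt (by norm_num)
  have := hd.hasFDerivAt.clm_apply (hasFDerivAt_const v p)
  simpa using this

theorem snd_fderiv_symm (u v : TCn d) :
    fderiv ℂ (fderiv ℂ S) p u v = fderiv ℂ (fderiv ℂ S) p v u := by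
  have h := fderiv_fderiv_apply_comm hΩ hS hp u v
  rw [(hasFDerivAt_fderiv_apply hΩ hS hp _).fderiv,
    (hasFDerivAt_fderiv_apply hΩ hS hp _).fderiv] at h
  simpa using h

theorem fderiv_sourceMap_apply (u : TCn d) :
    fderiv ℂ (sourceMap S) p u = (u.1,
      (fun j => -fderiv ℂ (fderiv ℂ S) p u ((Pi.single j 1, 0), 0),
        -fderiv ℂ (fderiv ℂ S) p u ((0, 1), 0))) := by
  have h := fun v => hasFDerivAt_fderiv_apply hΩ hS hp v
  have := (hasFDerivAt_fst (𝕜 := ℂ) (p := p)).prodMk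
    ((hasFDerivAt_pi.2 fun j : Fin d => (h ((Pi.single j 1, 0), 0)).fun_neg).prodMk
      (h ((0, 1), 0)).fun_neg)
  rw [show fderiv ℂ (sourceMap S) p = _ from this.fderiv]
  rfl

theorem fderiv_targetMap_apply (u : TCn d) :
    fderiv ℂ (targetMap e S) p u =
      ((fun j => -fderiv ℂ (fderiv ℂ S) p u (0, (Pi.single j 1, 0)), u.2.2),
        (u.2.1 - u.2.2 • e, fderiv ℂ (fderiv ℂ S) p u (0, (e, 1)))) := by
  have h := fun v => hasFDerivAt_fderiv_apply hΩ hS hp v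
  have h1 : HasFDerivAt (fun p : TCn d => p.2.2) ((ContinuousLinearMap.snd ℂ (Fin d → ℂ) ℂ).comp
      (ContinuousLinearMap.snd ℂ (Cn d) (Cn d))) p := ContinuousLinearMap.hasFDerivAt
        ((ContinuousLinearMap.snd ℂ (Fin d → ℂ) ℂ).comp (ContinuousLinearMap.snd ℂ (Cn d) (Cn d)))
  have h2 : HasFDerivAt (fun p : TCn d => p.2.1) ((ContinuousLinearMap.fst ℂ (Fin d → ℂ) ℂ).comp
      (ContinuousLinearMap.snd ℂ (Cn d) (Cn d))) p := ContinuousLinearMap.hasFDerivAt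
        ((ContinuousLinearMap.fst ℂ (Fin d → ℂ) ℂ).comp (ContinuousLinearMap.snd ℂ (Cn d) (Cn d)))
  have := ((hasFDerivAt_pi.2 fun j : Fin d => (h (0, (Pi.single j 1, 0))).fun_neg).prodMk
    h1).prodMk ((h2.fun_sub (h1.smul_const e)).prodMk (h (0, (e, 1))))
  rw [show fderiv ℂ (targetMap e S) p = _ from this.fderiv]
  rfl

/-- The two maps attached to a generating function pull the symplectic form back to the same
two-form. -/
theorem sympl_fderiv_targetMap (u v : TCn d) :
    sympl (fderiv ℂ (targetMap e S) p u) (fderiv ℂ (targetMap e S) p v) =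
      sympl (fderiv ℂ (sourceMap S) p u) (fderiv ℂ (sourceMap S) p v) := by
  rw [fderiv_targetMap_apply hΩ hS hp, fderiv_targetMap_apply hΩ hS hp,
    fderiv_sourceMap_apply hΩ hS hp, fderiv_sourceMap_apply hΩ hS hp]
  -- After expansion in coordinates the two forms differ by the antisymmetrization of the Hessian;
  -- the terms in `e` cancel within the target form.
  have hsym := snd_fderiv_symm hΩ hS hp u v
  set Q := fderiv ℂ (fderiv ℂ S) p
  have huv := clm_TCn_apply (Q u) v
  have hvu := clm_TCn_apply (Q v) u
  have hu := clm_TCn_apply (Q u) (0, (e, 1))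
  have hv := clm_TCn_apply (Q v) (0, (e, 1))
  simp only [sympl]
  have hneg : ∀ a : Fin d → ℂ, (fun j => -a j) = -a := fun a => rfl
  simp only [hneg, dotProduct_neg, neg_dotProduct, sub_dotProduct, smul_dotProduct, smul_eq_mul,
    Prod.fst_zero, Prod.snd_zero, dotProduct_zero, mul_zero, mul_one, zero_add] at *
  rw [hu, hv]
  rw [dotProduct_comm e, dotProduct_comm e, dotProduct_comm v.2.1, dotProduct_comm u.2.1]
  linear_combination hsym - huv + hvu

end GeneratingFunction

/-- A function `S(y, η, t)`, holomorphic on the conic open set `V`, homogeneous of degree one in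
`(η, t)`, equal to `y' · (t e - η)` on `y_n = 0` and with `∂_{y_n} S = i` at `(0; e, 1)`. -/
structure IsConicGenerator {d : ℕ} (e : Fin d → ℂ) (V : Set (TCn d)) (S : TCn d → ℂ) : Prop where
  isOpen : IsOpen V
  base_mem : ((0, (e, 1)) : TCn d) ∈ V
  conic : ∀ p ∈ V, ∀ c : ℝ, 0 < c → dilSource c p ∈ V
  holomorphic : DifferentiableOn ℂ S V
  homogeneous : ∀ p ∈ V, ∀ c : ℝ, 0 < c → S (dilSource c p) = c * S p
  initial : ∀ (y' η : Fin d → ℂ) (t : ℂ), (((y', 0), (η, t)) : TCn d) ∈ V →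
    S ((y', 0), (η, t)) = dotProduct y' (t • e - η)
  normal : fderiv ℂ S (0, (e, 1)) ((0, 1), 0) = Complex.I

/-! ### The two actions of the positive reals. -/

section Dilations

variable {d : ℕ}

/-- The dilation of the source as a continuous linear map. -/
noncomputable def dilSourceL (c : ℝ) : TCn d →L[ℂ] TCn d :=
  (ContinuousLinearMap.id ℂ (Cn d)).prodMap ((c : ℂ) • ContinuousLinearMap.id ℂ (Cn d))

/-- The dilation of the target as a continuous linear map. -/
noncomputable def dilTargetL (c : ℝ) : TCn d →L[ℂ] TCn d :=
  ((ContinuousLinearMap.id ℂ (Fin d → ℂ)).prodMap ((c : ℂ) • ContinuousLinearMap.id ℂ ℂ)).prodMap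
    (((c : ℂ) • ContinuousLinearMap.id ℂ (Fin d → ℂ)).prodMap (ContinuousLinearMap.id ℂ ℂ))

@[simp] theorem dilSourceL_apply (c : ℝ) (p : TCn d) : dilSourceL c p = dilSource c p := rfl

@[simp] theorem dilTargetL_apply (c : ℝ) (p : TCn d) : dilTargetL c p = dilTarget c p := rfl

theorem dilSource_dilSource (a b : ℝ) (p : TCn d) :
    dilSource a (dilSource b p) = dilSource (a * b) p := by
  simp only [dilSource, smul_smul, Complex.ofReal_mul]

@[simp] theorem dilSource_one (p : TCn d) : dilSource 1 p = p := by simp [dilSource]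

theorem dilTarget_dilTarget (a b : ℝ) (p : TCn d) :
    dilTarget a (dilTarget b p) = dilTarget (a * b) p := by
  simp only [dilTarget, smul_smul, mul_assoc, Complex.ofReal_mul]

@[simp] theorem dilTarget_one (p : TCn d) : dilTarget 1 p = p := by simp [dilTarget]

theorem dilSource_inv_dilSource {c : ℝ} (hc : 0 < c) (p : TCn d) :
    dilSource c⁻¹ (dilSource c p) = p := by
  rw [dilSource_dilSource, inv_mul_cancel₀ hc.ne', dilSource_one]

theorem dilSource_dilSource_inv {c : ℝ} (hc : 0 < c) (p : TCn d) :
    dilSource c (dilSource c⁻¹ p) = p := by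
  rw [dilSource_dilSource, mul_inv_cancel₀ hc.ne', dilSource_one]

theorem dilTarget_inv_dilTarget {c : ℝ} (hc : 0 < c) (p : TCn d) :
    dilTarget c⁻¹ (dilTarget c p) = p := by
  rw [dilTarget_dilTarget, inv_mul_cancel₀ hc.ne', dilTarget_one]

end Dilations

/-! ### Equivariance, and the Hessian at the base point. -/

namespace IsConicGenerator

variable {d : ℕ} {e : Fin d → ℂ} {V : Set (TCn d)} {S : TCn d → ℂ} (h : IsConicGenerator e V S)
include h

theorem differentiableAt {p : TCn d} (hp : p ∈ V) : DifferentiableAt ℂ S p :=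
  h.holomorphic.differentiableAt (h.isOpen.mem_nhds hp)

/-- Differentiated homogeneity. Consequently ∂_y S has degree one and ∂_{(η,t)} S degree zero, which
is the equivariance of the two maps. -/
theorem fderiv_dilSource {p : TCn d} (hp : p ∈ V) {c : ℝ} (hc : 0 < c) (u : TCn d) :
    fderiv ℂ S (dilSource c p) (dilSource c u) = c * fderiv ℂ S p u := by
  have h1 : HasFDerivAt (fun q => S (dilSourceL c q))
      ((fderiv ℂ S (dilSource c p)).comp (dilSourceL c)) p :=
    (h.differentiableAt (h.conic p hp c hc)).hasFDerivAt.comp p (dilSourceL c).hasFDerivAt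
  have h2 : (fun q => S (dilSourceL c q)) =ᶠ[𝓝 p] fun q => (c : ℂ) * S q := by
    filter_upwards [h.isOpen.mem_nhds hp] with q hq using h.homogeneous q hq c hc
  have h3 := (h.differentiableAt hp).hasFDerivAt.const_mul (c : ℂ)
  have h4 := DFunLike.congr_fun (h1.unique (h3.congr_of_eventuallyEq h2)) u
  simpa using h4

theorem sourceMap_dilSource {p : TCn d} (hp : p ∈ V) {c : ℝ} (hc : 0 < c) :
    sourceMap S (dilSource c p) = dilSource c (sourceMap S p) := by
  have h1 : ∀ v : Cn d, fderiv ℂ S (dilSource c p) (v, 0) = c * fderiv ℂ S p (v, 0) := by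
    intro v
    have := h.fderiv_dilSource hp hc (v, 0)
    simpa [dilSource] using this
  simp only [sourceMap, h1]
  ext <;> simp [dilSource]

theorem targetMap_dilSource {p : TCn d} (hp : p ∈ V) {c : ℝ} (hc : 0 < c) :
    targetMap e S (dilSource c p) = dilTarget c (targetMap e S p) := by
  have hc' : (c : ℂ) ≠ 0 := by exact_mod_cast hc.ne'
  have h1 : ∀ v : Cn d, fderiv ℂ S (dilSource c p) (0, v) = fderiv ℂ S p (0, v) := by
    intro v
    have := h.fderiv_dilSource hp hc (0, v)
    have e1 : dilSource c ((0, v) : TCn d) = (c : ℂ) • (0, v) := by simp [dilSource]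
    rw [e1, map_smul, smul_eq_mul] at this
    exact mul_left_cancel₀ hc' this
  simp only [targetMap, h1]
  simp only [dilSource, dilTarget]
  refine Prod.ext rfl (Prod.ext ?_ rfl)
  simp [smul_sub, smul_smul]

theorem euler {p : TCn d} (hp : p ∈ V) : fderiv ℂ S p (0, p.2) = S p := by
  have h1 := hasDerivAt_line (f := S) (x := (p.1, 0)) (v := (0, p.2)) (z := ((1 : ℝ) : ℂ))
    (by simpa using h.differentiableAt hp)
  have h2 := h1.comp_ofReal
  have h3 : (fun c : ℝ => S ((p.1, 0) + (c : ℂ) • (0, p.2))) =ᶠ[𝓝 1] fun c => (c : ℂ) * S p := by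
    filter_upwards [lt_mem_nhds one_pos] with c hc
    rw [← h.homogeneous p hp c hc]
    simp [dilSource]
  have h4 : HasDerivAt (fun c : ℝ => (c : ℂ) * S p) (S p) 1 := by
    simpa using (hasDerivAt_id ((1 : ℝ) : ℂ)).comp_ofReal.mul_const (S p)
  have := h2.unique (h4.congr_of_eventuallyEq h3)
  simpa using this

theorem fderiv_of_boundary {y' η : Fin d → ℂ} {t : ℂ} (hp : (((y', 0), (η, t)) : TCn d) ∈ V)
    (v ζ : Fin d → ℂ) (τ : ℂ) :
    fderiv ℂ S ((y', 0), (η, t)) ((v, 0), (ζ, τ)) =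
      dotProduct v (t • e - η) + dotProduct y' (τ • e - ζ) := by
  have h1 := hasDerivAt_line (f := S) (x := ((y', 0), (η, t))) (v := ((v, 0), (ζ, τ))) (z := 0)
    (by simpa using h.differentiableAt hp)
  have h2 : (fun z : ℂ => S (((y', 0), (η, t)) + z • ((v, 0), (ζ, τ)))) =ᶠ[𝓝 0]
      fun z => dotProduct y' (t • e - η) +
        z * (dotProduct v (t • e - η) + dotProduct y' (τ • e - ζ)) +
        z ^ 2 * dotProduct v (τ • e - ζ) := by
    have hc : Continuous fun z : ℂ => (((y', 0), (η, t)) : TCn d) + z • ((v, 0), (ζ, τ)) := by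
      fun_prop
    have := hc.tendsto 0
    simp only [zero_smul, add_zero] at this
    filter_upwards [this (h.isOpen.mem_nhds hp)] with z hz
    have e1 : (((y', 0), (η, t)) : TCn d) + z • ((v, 0), (ζ, τ)) =
        ((y' + z • v, 0), (η + z • ζ, t + z * τ)) := by simp
    rw [mem_preimage, e1] at hz
    rw [e1, h.initial _ _ _ hz]
    simp only [add_dotProduct, dotProduct_sub, dotProduct_add, smul_dotProduct, dotProduct_smul,
      smul_eq_mul]
    ring
  have h3 := (((hasDerivAt_id (0 : ℂ)).mul_const
    (dotProduct v (t • e - η) + dotProduct y' (τ • e - ζ))).const_add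
      (dotProduct y' (t • e - η))).fun_add
        ((hasDerivAt_pow 2 (0 : ℂ)).mul_const (dotProduct v (τ • e - ζ)))
  have := h1.unique (h3.congr_of_eventuallyEq h2)
  simpa using this

/-- Both directions are tangent to y_n = 0, where S is explicitly known. No boundary information is
available on entries involving ∂_{y_n}; `snd_fderiv_radial` supplies the one that is needed. -/
theorem snd_fderiv_of_boundary (u' v' ζ ζ' : Fin d → ℂ) (τ τ' : ℂ) :
    fderiv ℂ (fderiv ℂ S) (0, (e, 1)) ((u', 0), (ζ, τ)) ((v', 0), (ζ', τ')) =
      dotProduct v' (τ • e - ζ) + dotProduct u' (τ' • e - ζ') := by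
  have h0 := (hasFDerivAt_fderiv_apply h.isOpen h.holomorphic h.base_mem
    ((v', 0), (ζ', τ')))
  have hl : HasDerivAt (fun z : ℂ => ((0, (e, 1)) : TCn d) + z • ((u', 0), (ζ, τ)))
      ((u', 0), (ζ, τ)) 0 := by
    simpa using ((hasDerivAt_id (0 : ℂ)).smul_const (((u', 0), (ζ, τ)) : TCn d)).const_add
      ((0, (e, 1)) : TCn d)
  have h1 := HasFDerivAt.comp_hasDerivAt_of_eq (f := fun z : ℂ => ((0, (e, 1)) : TCn d) +
    z • ((u', 0), (ζ, τ))) 0 h0 hl (by simp)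
  have h2 : (fun z : ℂ => fderiv ℂ S (((0, (e, 1)) : TCn d) + z • ((u', 0), (ζ, τ)))
      ((v', 0), (ζ', τ'))) =ᶠ[𝓝 0]
      fun z => z * (dotProduct v' (τ • e - ζ) + dotProduct u' (τ' • e - ζ')) := by
    have := hl.continuousAt.tendsto
    simp only [zero_smul, add_zero] at this
    filter_upwards [this (h.isOpen.mem_nhds h.base_mem)] with z hz
    have e1 : ((0, (e, 1)) : TCn d) + z • ((u', 0), (ζ, τ)) =
        ((z • u', 0), (e + z • ζ, 1 + z * τ)) := by
      refine Prod.ext (Prod.ext ?_ ?_) (Prod.ext ?_ ?_) <;> simp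
    rw [mem_preimage, e1] at hz
    rw [e1, h.fderiv_of_boundary hz]
    simp only [dotProduct_sub, dotProduct_add, smul_dotProduct, dotProduct_smul,
      smul_eq_mul, add_smul, one_smul]
    ring
  have h3 := (hasDerivAt_id (0 : ℂ)).mul_const
    (dotProduct v' (τ • e - ζ) + dotProduct u' (τ' • e - ζ'))
  have := h1.unique (h3.congr_of_eventuallyEq h2)
  simpa using this

/-- Differentiate Euler's identity dS(0, p.2) = S in direction u: the terms in u.2 cancel, leaving
dS(u.1, 0). At the base point its tangential part vanishes and its normal part is `normal`. -/
theorem snd_fderiv_radial (u : TCn d) :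
    fderiv ℂ (fderiv ℂ S) (0, (e, 1)) u (0, (e, 1)) = u.1.2 * Complex.I := by
  have hd : DifferentiableAt ℂ (fderiv ℂ S) (0, (e, 1)) :=
    ((contDiffAt_of_differentiableOn h.isOpen h.holomorphic h.base_mem 2).fderiv_right (m := 1)
      (by norm_num)).differentiableAt (by norm_num)
  have hE : (fun p : TCn d => fderiv ℂ S p (0, p.2)) =ᶠ[𝓝 (0, (e, 1))] S := by
    filter_upwards [h.isOpen.mem_nhds h.base_mem] with p hp using h.euler hp
  have hproj : HasFDerivAt (fun p : TCn d => ((0, p.2) : TCn d))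
      ((ContinuousLinearMap.inr ℂ (Cn d) (Cn d)).comp (ContinuousLinearMap.snd ℂ (Cn d) (Cn d)))
      (0, (e, 1)) := ContinuousLinearMap.hasFDerivAt
        ((ContinuousLinearMap.inr ℂ (Cn d) (Cn d)).comp (ContinuousLinearMap.snd ℂ (Cn d) (Cn d)))
  have h1 := hd.hasFDerivAt.clm_apply hproj
  have h2 := (h.differentiableAt h.base_mem).hasFDerivAt.congr_of_eventuallyEq hE
  have h3 := DFunLike.congr_fun (h1.unique h2) u
  have h4 : fderiv ℂ S (0, (e, 1)) u =
      fderiv ℂ S (0, (e, 1)) (u.1, 0) + fderiv ℂ S (0, (e, 1)) (0, u.2) := by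
    rw [← map_add]; simp
  have h5 : fderiv ℂ S (0, (e, 1)) (u.1, 0) = u.1.2 * Complex.I := by
    have e1 : ((u.1, 0) : TCn d) = ((u.1.1, 0), (0, 0)) + u.1.2 • ((0, 1), 0) := by
      refine Prod.ext (Prod.ext ?_ ?_) (Prod.ext ?_ ?_) <;> simp
    rw [e1, map_add, map_smul, h.normal]
    have := h.fderiv_of_boundary (y' := 0) h.base_mem u.1.1 0 0
    have h6 : fderiv ℂ S (0, (e, 1)) ((u.1.1, 0), (0, 0)) = 0 := by
      refine Eq.trans this ?_
      simp
    rw [h6]; simp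
  rw [h4, h5] at h3
  rw [add_comm] at h3
  exact add_right_cancel h3

/-- A kernel vector has no y component; the tangential Hessian forces it to be a multiple τ of the
radial vector, and its pairing iτ with ∂_{y_n} forces τ = 0. -/
theorem injective_fderiv_sourceMap :
    Function.Injective (fderiv ℂ (sourceMap S) (0, (e, 1))) := by
  rw [injective_iff_map_eq_zero]
  intro u hu
  rw [fderiv_sourceMap_apply h.isOpen h.holomorphic h.base_mem] at hu
  obtain ⟨y, ⟨ζ, τ⟩⟩ := u
  simp only [Prod.mk_eq_zero, neg_eq_zero] at hu
  obtain ⟨rfl, hA, hN⟩ := hu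
  have hζ : ζ = τ • e := by
    ext j
    have h1 := congrFun hA j
    have h2 := h.snd_fderiv_of_boundary 0 (Pi.single j 1) ζ 0 τ 0
    simp only [neg_eq_zero, Pi.zero_apply] at h1
    have h3 : dotProduct (Pi.single j 1) (τ • e - ζ) = 0 := by
      have := h2.symm.trans h1
      simpa using this
    simp only [single_one_dotProduct, Pi.sub_apply] at h3
    exact (sub_eq_zero.1 h3).symm
  have e1 : ((0, (ζ, τ)) : TCn d) = τ • (0, (e, 1)) := by rw [hζ]; simp
  rw [e1, map_smul, smul_apply, snd_fderiv_symm h.isOpen h.holomorphic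
    h.base_mem, h.snd_fderiv_radial] at hN
  have hτ : τ = 0 := by simpa using hN
  rw [e1, hτ, zero_smul]

/-- The t and η − te components kill the fibre part, the pairing with the radial vector kills the
y_n part, and the tangential Hessian then kills the y' part. -/
theorem injective_fderiv_targetMap :
    Function.Injective (fderiv ℂ (targetMap e S) (0, (e, 1))) := by
  rw [injective_iff_map_eq_zero]
  intro u hu
  rw [fderiv_targetMap_apply h.isOpen h.holomorphic h.base_mem, h.snd_fderiv_radial] at hu
  obtain ⟨⟨a, b⟩, ⟨ζ, τ⟩⟩ := u
  simp only [Prod.mk_eq_zero] at hu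
  obtain ⟨⟨hC, rfl⟩, hζ, hb⟩ := hu
  have hζ' : ζ = 0 := by simpa using hζ
  have hb' : b = 0 := by simpa using hb
  subst hζ' hb'
  have ha : a = 0 := by
    ext j
    have h1 := congrFun hC j
    have h2 := h.snd_fderiv_of_boundary a 0 0 (Pi.single j 1) 0 0
    simp only [neg_eq_zero, Pi.zero_apply] at h1
    have := h2.symm.trans h1
    simpa using this
  subst ha
  rfl

theorem sourceMap_base :
    sourceMap S (0, (e, 1)) = (((0, 0), (0, -Complex.I)) : TCn d) := by
  have h1 : ∀ v, fderiv ℂ S (0, (e, 1)) ((v, 0), 0) = 0 := fun v =>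
    (h.fderiv_of_boundary (y' := 0) h.base_mem v 0 0).trans (by simp)
  simp only [sourceMap, h1, h.normal, neg_zero]
  rfl

theorem targetMap_base :
    targetMap e S (0, (e, 1)) = (((0, 1), (0, 0)) : TCn d) := by
  have h1 : ∀ ζ τ, fderiv ℂ S (0, (e, 1)) (0, (ζ, τ)) = 0 := fun ζ τ =>
    (h.fderiv_of_boundary (y' := 0) h.base_mem 0 ζ τ).trans (by simp)
  simp only [targetMap, h1, neg_zero, one_smul, sub_self]
  rfl

end IsConicGenerator

/-- Carries infinitesimal injectivity from a point near the base point to all its dilates. -/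
theorem injective_fderiv_of_semiconj {E : Type*} [NormedAddCommGroup E] [NormedSpace ℂ E] {f : E → E}
    {A A' B B' : E →L[ℂ] E} {p : E} (hAA' : ∀ x, A (A' x) = x)
    (hB : ∀ x, B' (B x) = x) (hf : DifferentiableAt ℂ f p) (hf' : DifferentiableAt ℂ f (A p))
    (h : ∀ᶠ q in 𝓝 p, f (A q) = B (f q)) (hL : Function.Injective (fderiv ℂ f p)) :
    Function.Injective (fderiv ℂ f (A p)) := by
  have h1 : HasFDerivAt (fun q => f (A q)) ((fderiv ℂ f (A p)).comp A) p :=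
    hf'.hasFDerivAt.comp p A.hasFDerivAt
  have h2 : HasFDerivAt (fun q => B (f q)) (B.comp (fderiv ℂ f p)) p :=
    B.hasFDerivAt.comp p hf.hasFDerivAt
  have h3 := h1.unique (h2.congr_of_eventuallyEq h)
  rw [injective_iff_map_eq_zero]
  intro u hu
  have h4 : B (fderiv ℂ f p (A' u)) = 0 := by
    have := DFunLike.congr_fun h3 (A' u)
    simp only [ContinuousLinearMap.comp_apply, hAA', hu] at this
    exact this.symm
  have h5 : fderiv ℂ f p (A' u) = 0 := by rw [← hB (fderiv ℂ f p (A' u)), h4, map_zero]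
  have h6 : A' u = 0 := hL (h5.trans (map_zero _).symm)
  rw [← hAA' u, h6, map_zero]

/-! ### The inverse function theorem. -/

section LocalInverse

variable {E : Type*} [NormedAddCommGroup E] [NormedSpace ℂ E] [FiniteDimensional ℂ E]
  {f : E → E} {V : Set E}

theorem exists_equiv_hasStrictFDerivAt {p : E} (hf : ContDiffAt ℂ 1 f p)
    (hL : Function.Injective (fderiv ℂ f p)) :
    ∃ L : E ≃L[ℂ] E, (L : E →L[ℂ] E) = fderiv ℂ f p ∧
      HasStrictFDerivAt f (L : E →L[ℂ] E) p := by
  have h : (((LinearEquiv.ofInjectiveEndo (fderiv ℂ f p : E →ₗ[ℂ] E)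
      hL).toContinuousLinearEquiv : E ≃L[ℂ] E) : E →L[ℂ] E) = fderiv ℂ f p := by
    ext x; rfl
  refine ⟨_, h, ?_⟩
  rw [h]
  exact hf.hasStrictFDerivAt (by norm_num)

/-- An injective `C¹` map with invertible derivatives is biholomorphic onto its image. -/
theorem exists_openPartialHomeomorph (hV : IsOpen V) (hf : ∀ p ∈ V, ContDiffAt ℂ 1 f p)
    (hL : ∀ p ∈ V, Function.Injective (fderiv ℂ f p)) (hinj : InjOn f V) :
    ∃ κ : OpenPartialHomeomorph E E, κ.source = V ∧ κ.target = f '' V ∧ (∀ x, κ x = f x) ∧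
      ∀ p ∈ V, ∃ L : E ≃L[ℂ] E, (L : E →L[ℂ] E) = fderiv ℂ f p ∧
        HasFDerivAt κ.symm (L.symm : E →L[ℂ] E) (f p) := by
  have hopen : IsOpenMap (V.domRestrict f) := by
    intro s hs
    obtain ⟨t, ht, rfl⟩ := isOpen_induced_iff.1 hs
    rw [isOpen_iff_mem_nhds]
    rintro _ ⟨⟨p, hp⟩, hpt, rfl⟩
    obtain ⟨L, -, hL'⟩ := exists_equiv_hasStrictFDerivAt (hf p hp) (hL p hp)
    change _ ∈ 𝓝 (f p)
    rw [← hL'.map_nhds_eq_of_equiv]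
    refine mem_map.2 ?_
    filter_upwards [hV.mem_nhds hp, ht.mem_nhds hpt] with q hq hqt
    exact ⟨⟨q, hq⟩, hqt, rfl⟩
  set κ : OpenPartialHomeomorph E E := OpenPartialHomeomorph.ofContinuousOpenRestrict
    (hinj.toPartialEquiv f V) (fun p hp => (hf p hp).continuousAt.continuousWithinAt) hopen hV
  have hκ : ∀ x, κ x = f x := fun x => rfl
  refine ⟨κ, rfl, rfl, hκ, fun p hp => ?_⟩
  obtain ⟨L, h1, h2⟩ := exists_equiv_hasStrictFDerivAt (hf p hp) (hL p hp)
  refine ⟨L, h1, ?_⟩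
  have hmem : f p ∈ κ.target := mem_image_of_mem f hp
  have hsymm : κ.symm (f p) = p := κ.left_inv (x := p) hp
  refine κ.hasFDerivAt_symm hmem ?_
  rw [hsymm]
  exact h2.hasFDerivAt

theorem eventually_injective_fderiv {p : E} (hf : ContDiffAt ℂ 1 f p)
    (hL : Function.Injective (fderiv ℂ f p)) :
    ∀ᶠ q in 𝓝 p, Function.Injective (fderiv ℂ f q) := by
  have hc : ContinuousAt (fderiv ℂ f) p :=
    (hf.fderiv_right (m := 0) (by norm_num)).continuousAt
  exact hc (ContinuousLinearMap.isOpen_injective.mem_nhds hL)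

theorem exists_nhds_injOn {p : E} (hf : ContDiffAt ℂ 1 f p)
    (hL : Function.Injective (fderiv ℂ f p)) : ∃ N ∈ 𝓝 p, InjOn f N := by
  obtain ⟨L, -, h⟩ := exists_equiv_hasStrictFDerivAt hf hL
  exact ⟨_, (h.toOpenPartialHomeomorph f).open_source.mem_nhds h.mem_toOpenPartialHomeomorph_source,
    (h.toOpenPartialHomeomorph f).injOn⟩

end LocalInverse

/-! ### From a neighbourhood of the base point to a conic one. -/

namespace IsConicGenerator

variable {d : ℕ} {e : Fin d → ℂ} {V : Set (TCn d)} {S : TCn d → ℂ} (h : IsConicGenerator e V S)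
include h

theorem contDiffAt_sourceMap {p : TCn d} (hp : p ∈ V) : ContDiffAt ℂ 1 (sourceMap S) p := by
  exact_mod_cast DNSymbol.contDiffAt_sourceMap h.isOpen h.holomorphic hp 1

theorem contDiffAt_targetMap {p : TCn d} (hp : p ∈ V) : ContDiffAt ℂ 1 (targetMap e S) p := by
  exact_mod_cast DNSymbol.contDiffAt_targetMap h.isOpen h.holomorphic hp e 1

/-- Near the base point, `sourceMap S` separates dilation orbits. -/
theorem eventually_eq_dilSource :
    ∀ᶠ q : TCn d × TCn d in 𝓝 ((0, (e, 1)), (0, (e, 1))), ∀ c : ℝ, 0 < c →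
      sourceMap S q.1 = dilSource c (sourceMap S q.2) → q.1 = dilSource c q.2 := by
  obtain ⟨N, hN, hinj⟩ := exists_nhds_injOn (h.contDiffAt_sourceMap h.base_mem)
    h.injective_fderiv_sourceMap
  -- Im y_n* is −1 at the base point and scales by c under dilation. A relation between the two
  -- images therefore forces c = m q.1 / m q.2, which is near 1, and local injectivity applies to
  -- the dilated point.
  set m : TCn d → ℝ := fun p => (sourceMap S p).2.2.im with hm
  have hm0 : m (0, (e, 1)) = -1 := by simp [hm, h.sourceMap_base]
  have hFc : ContinuousAt (sourceMap S) (0, (e, 1)) :=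
    (h.contDiffAt_sourceMap h.base_mem).continuousAt
  have hmc : ContinuousAt m (0, (e, 1)) :=
    Complex.continuous_im.continuousAt.comp (continuousAt_snd.comp (continuousAt_snd.comp hFc))
  set q₀ : TCn d × TCn d := ((0, (e, 1)), (0, (e, 1))) with hq₀
  have hm1 : ContinuousAt (fun q : TCn d × TCn d => m q.1) q₀ :=
    ContinuousAt.comp (f := Prod.fst) (x := q₀) hmc continuousAt_fst
  have hm2 : ContinuousAt (fun q : TCn d × TCn d => m q.2) q₀ :=
    ContinuousAt.comp (f := Prod.snd) (x := q₀) hmc continuousAt_snd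
  have hq₀2 : m q₀.2 ≠ 0 := by simp [hq₀, hm0]
  have hR : ContinuousAt (fun q : TCn d × TCn d => m q.1 / m q.2) q₀ := hm1.div hm2 hq₀2
  have hD : ContinuousAt (fun q : TCn d × TCn d => dilSource (m q.1 / m q.2) q.2) q₀ := by
    unfold dilSource
    exact (continuousAt_fst.comp continuousAt_snd).prodMk
      ((Complex.continuous_ofReal.continuousAt.comp hR).smul
        (continuousAt_snd.comp continuousAt_snd))
  have hD0 : dilSource (m q₀.1 / m q₀.2) q₀.2 = (0, (e, 1)) := by
    simp [hq₀, hm0]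
  have e1 : ∀ᶠ q : TCn d × TCn d in 𝓝 q₀, q.1 ∈ N := (continuousAt_fst (p := q₀)) hN
  have e2 : ∀ᶠ q : TCn d × TCn d in 𝓝 q₀, q.2 ∈ V :=
    (continuousAt_snd (p := q₀)) (h.isOpen.mem_nhds h.base_mem)
  have e3 : ∀ᶠ q : TCn d × TCn d in 𝓝 q₀, dilSource (m q.1 / m q.2) q.2 ∈ N := by
    exact hD.eventually_mem (hD0.symm ▸ hN)
  have e4 : ∀ᶠ q : TCn d × TCn d in 𝓝 q₀, m q.2 ≠ 0 := hm2.eventually_ne hq₀2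
  filter_upwards [e1, e2, e3, e4] with q h1 h2 h3 h4 c hc heq
  have hmq : m q.1 = c * m q.2 := by
    simp only [hm]
    rw [heq]
    simp [dilSource]
  rw [hmq, mul_div_cancel_right₀ _ h4] at h3
  exact hinj h1 h3 (heq.trans (h.sourceMap_dilSource h2 hc).symm)

/-- A conic neighbourhood, of product type, of the base point on which both maps of the
generating function are injective local biholomorphisms. -/
theorem exists_conic_neighborhood :
    ∃ V' ⊆ V, IsConicGenerator e V' S ∧ (∀ p ∈ V', ∀ q ∈ V', (p.1, q.2) ∈ V') ∧
      (∀ p ∈ V', Function.Injective (fderiv ℂ (sourceMap S) p)) ∧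
      (∀ p ∈ V', Function.Injective (fderiv ℂ (targetMap e S) p)) ∧
      InjOn (sourceMap S) V' ∧ InjOn (targetMap e S) V' := by
  have e1 := eventually_injective_fderiv (h.contDiffAt_sourceMap h.base_mem)
    h.injective_fderiv_sourceMap
  have e2 := eventually_injective_fderiv (h.contDiffAt_targetMap h.base_mem)
    h.injective_fderiv_targetMap
  obtain ⟨N, hN, hNinj⟩ := exists_nhds_injOn (h.contDiffAt_targetMap h.base_mem)
    h.injective_fderiv_targetMap
  have e0 := h.eventually_eq_dilSource
  rw [nhds_prod_eq, eventually_prod_iff] at e0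
  obtain ⟨V₁, hV₁, V₂, hV₂, hV₂'⟩ := e0
  have e3 : ∀ᶠ p : TCn d in 𝓝 (0, (e, 1)), p ∈ V := h.isOpen.mem_nhds h.base_mem
  have e4 : ∀ᶠ p : TCn d in 𝓝 (0, (e, 1)), p ∈ N := hN
  obtain ⟨r, hr, hball⟩ := Metric.eventually_nhds_iff_ball.1
    (e1.and (e2.and (e3.and (e4.and (hV₁.and hV₂)))))
  -- Points whose dilate with Re t = 1 lies in a small ball around the base point. The y condition
  -- and the (η, t) condition are separate, whence the product property.
  set V' : Set (TCn d) := {p | p.1 ∈ ball 0 r ∧ 0 < p.2.2.re ∧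
    ((p.2.2.re)⁻¹ : ℂ) • p.2 ∈ ball (e, 1) r} with hV'
  have hnorm : ∀ p ∈ V', dilSource (p.2.2.re)⁻¹ p ∈ ball ((0, (e, 1)) : TCn d) r := by
    rintro p ⟨hp1, -, hp3⟩
    rw [← ball_prod_same]
    refine ⟨hp1, ?_⟩
    simpa [dilSource] using hp3
  have hconic : ∀ p ∈ V', ∀ c : ℝ, 0 < c → dilSource c p ∈ V' := by
    rintro p ⟨hp1, hp2, hp3⟩ c hc
    have hc' : (c : ℂ) ≠ 0 := by exact_mod_cast hc.ne'
    have hre : (dilSource c p).2.2.re = c * p.2.2.re := by simp [dilSource]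
    refine ⟨hp1, by rw [hre]; positivity, ?_⟩
    rw [hre]
    simp only [dilSource, smul_smul]
    have : ((↑(c * p.2.2.re) : ℂ))⁻¹ * (c : ℂ) = (p.2.2.re : ℂ)⁻¹ := by
      rw [Complex.ofReal_mul, mul_inv, mul_assoc, mul_comm, mul_assoc, mul_inv_cancel₀ hc', mul_one]
    rw [this]; exact hp3
  have hsub : V' ⊆ V := by
    intro p hp
    have := h.conic _ (hball _ (hnorm p hp)).2.2.1 _ hp.2.1
    rwa [dilSource_dilSource_inv hp.2.1] at this
  have hopen : IsOpen V' := by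
    have h1 : IsOpen {p : TCn d | p.1 ∈ ball (0 : Cn d) r ∧ 0 < p.2.2.re} :=
      (isOpen_ball.preimage continuous_fst).inter
        (isOpen_lt continuous_const (by fun_prop : Continuous fun p : TCn d => p.2.2.re))
    have h2 : ContinuousOn (fun p : TCn d => ((p.2.2.re)⁻¹ : ℂ) • p.2)
        {p : TCn d | p.1 ∈ ball (0 : Cn d) r ∧ 0 < p.2.2.re} := by
      refine ContinuousOn.smul (ContinuousOn.inv₀ (Complex.continuous_ofReal.comp
        (by fun_prop : Continuous fun p : TCn d => p.2.2.re)).continuousOn fun p hp => ?_)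
        continuous_snd.continuousOn
      exact Complex.ofReal_ne_zero.2 hp.2.ne'
    have h3 := h2.isOpen_inter_preimage h1 (isOpen_ball (x := ((e, 1) : Cn d)) (ε := r))
    convert h3 using 1
    ext p
    simp [hV', and_assoc]
  have hre : ∀ {p : TCn d}, p ∈ V' → p.2.2.re ≠ 0 := fun hp => hp.2.1.ne'
  refine ⟨V', hsub, ⟨hopen, ?_, hconic, h.holomorphic.mono hsub,
    fun p hp => h.homogeneous p (hsub hp), fun y' η t hp => h.initial y' η t (hsub hp), h.normal⟩,
    fun p hp q hq => ⟨hp.1, hq.2⟩, ?_, ?_, ?_, ?_⟩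
  · refine ⟨mem_ball_self hr, by simp, ?_⟩
    simpa using hr
  · intro p hp
    have hn := hball _ (hnorm p hp)
    have := injective_fderiv_of_semiconj (f := sourceMap S) (A := dilSourceL p.2.2.re)
      (A' := dilSourceL (p.2.2.re)⁻¹) (B := dilSourceL p.2.2.re) (B' := dilSourceL (p.2.2.re)⁻¹)
      (p := dilSource (p.2.2.re)⁻¹ p) (dilSource_dilSource_inv hp.2.1)
      (dilSource_inv_dilSource hp.2.1)
      ((h.contDiffAt_sourceMap hn.2.2.1).differentiableAt (by norm_num))
      ((h.contDiffAt_sourceMap (h.conic _ hn.2.2.1 _ hp.2.1)).differentiableAt (by norm_num))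
      (eventually_of_mem (h.isOpen.mem_nhds hn.2.2.1) fun q hq =>
        h.sourceMap_dilSource hq hp.2.1) hn.1
    rwa [dilSourceL_apply, dilSource_dilSource_inv hp.2.1] at this
  · intro p hp
    have hn := hball _ (hnorm p hp)
    have := injective_fderiv_of_semiconj (f := targetMap e S) (A := dilSourceL p.2.2.re)
      (A' := dilSourceL (p.2.2.re)⁻¹) (B := dilTargetL p.2.2.re) (B' := dilTargetL (p.2.2.re)⁻¹)
      (p := dilSource (p.2.2.re)⁻¹ p) (dilSource_dilSource_inv hp.2.1)
      (dilTarget_inv_dilTarget hp.2.1)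
      ((h.contDiffAt_targetMap hn.2.2.1).differentiableAt (by norm_num))
      ((h.contDiffAt_targetMap (h.conic _ hn.2.2.1 _ hp.2.1)).differentiableAt (by norm_num))
      (eventually_of_mem (h.isOpen.mem_nhds hn.2.2.1) fun q hq =>
        h.targetMap_dilSource hq hp.2.1) hn.2.1
    rwa [dilSourceL_apply, dilSource_dilSource_inv hp.2.1] at this
  -- The source map does not record t, so the normalized points have images agreeing only up to a
  -- dilation; this is why orbits had to be separated.
  · intro p hp q hq heq
    have hp' := hball _ (hnorm p hp)
    have hq' := hball _ (hnorm q hq)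
    have h1 := hV₂' hp'.2.2.2.2.1 hq'.2.2.2.2.2 ((p.2.2.re)⁻¹ * q.2.2.re)
      (mul_pos (inv_pos.2 hp.2.1) hq.2.1) (by
        change sourceMap S (dilSource (p.2.2.re)⁻¹ p) =
          dilSource _ (sourceMap S (dilSource (q.2.2.re)⁻¹ q))
        rw [h.sourceMap_dilSource (hsub hp) (inv_pos.2 hp.2.1),
          h.sourceMap_dilSource (hsub hq) (inv_pos.2 hq.2.1), dilSource_dilSource, heq, mul_assoc,
          mul_inv_cancel₀ (hre hq), mul_one])
    change dilSource (p.2.2.re)⁻¹ p = dilSource _ (dilSource (q.2.2.re)⁻¹ q) at h1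
    rw [dilSource_dilSource, mul_assoc, mul_inv_cancel₀ (hre hq), mul_one] at h1
    have h2 := congrArg (dilSource p.2.2.re) h1
    rwa [dilSource_dilSource_inv hp.2.1, dilSource_dilSource_inv hp.2.1] at h2
  -- Here t is a component of the image, so both points are normalized by the same factor and plain
  -- local injectivity is enough.
  · intro p hp q hq heq
    have ht : p.2.2 = q.2.2 := congrArg (fun ρ : TCn d => ρ.1.2) heq
    have hp' := hball _ (hnorm p hp)
    have hq' := hball _ (hnorm q hq)
    rw [← ht] at hq'
    have h1 := hNinj hp'.2.2.2.1 hq'.2.2.2.1 (by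
      rw [h.targetMap_dilSource (hsub hp) (inv_pos.2 hp.2.1),
        h.targetMap_dilSource (hsub hq) (inv_pos.2 hp.2.1), heq])
    have h2 := congrArg (dilSource p.2.2.re) h1
    rwa [dilSource_dilSource_inv hp.2.1, dilSource_dilSource_inv hp.2.1] at h2

/-- The canonical transformation defined by a conic generating function. -/
theorem exists_canonicalTransformation :
    ∃ (V' : Set (TCn d)) (κ : OpenPartialHomeomorph (TCn d) (TCn d)), V' ⊆ V ∧
      ((0, (e, 1)) : TCn d) ∈ V' ∧ (∀ p ∈ V', ∀ c : ℝ, 0 < c → dilSource c p ∈ V') ∧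
      (∀ p ∈ V', ∀ q ∈ V', (p.1, q.2) ∈ V') ∧ IsCanonicalTransformation κ ∧
      κ.source = sourceMap S '' V' ∧ κ.target = targetMap e S '' V' ∧
      ∀ p ∈ V', κ (sourceMap S p) = targetMap e S p := by
  obtain ⟨V', hsub, h', hprod, hDF, hDH, hF, hH⟩ := h.exists_conic_neighborhood
  obtain ⟨κF, hFs, hFt, hFe, hFd⟩ := exists_openPartialHomeomorph h'.isOpen
    (fun p hp => h'.contDiffAt_sourceMap hp) hDF hF
  obtain ⟨κH, hHs, hHt, hHe, hHd⟩ := exists_openPartialHomeomorph h'.isOpen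
    (fun p hp => h'.contDiffAt_targetMap hp) hDH hH
  have hFinv : ∀ p ∈ V', κF.symm (sourceMap S p) = p := fun p hp => by
    rw [← hFe]; exact κF.left_inv (hFs ▸ hp)
  have hHinv : ∀ p ∈ V', κH.symm (targetMap e S p) = p := fun p hp => by
    rw [← hHe]; exact κH.left_inv (hHs ▸ hp)
  have hFeq : (κF : TCn d → TCn d) = sourceMap S := funext hFe
  have hHeq : (κH : TCn d → TCn d) = targetMap e S := funext hHe
  -- The composition of `targetMap` with the inverse of `sourceMap`.
  set κ := κF.symm.trans' κH (by simp [hFs, hHs]) with hκ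
  have hκs : κ.source = sourceMap S '' V' := hFt
  have hκt : κ.target = targetMap e S '' V' := hHt
  have hκe : ∀ p ∈ V', κ (sourceMap S p) = targetMap e S p := fun p hp => by
    change κH (κF.symm (sourceMap S p)) = _
    rw [hFinv p hp, hHe]
  have hder : ∀ p ∈ V', ∃ L : TCn d ≃L[ℂ] TCn d,
      (L : TCn d →L[ℂ] TCn d) = fderiv ℂ (sourceMap S) p ∧
      HasFDerivAt κ ((fderiv ℂ (targetMap e S) p).comp (L.symm : TCn d →L[ℂ] TCn d))
        (sourceMap S p) := by
    intro p hp
    obtain ⟨L, hL, hLd⟩ := hFd p hp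
    refine ⟨L, hL, ?_⟩
    have h1 : HasFDerivAt κH (fderiv ℂ (targetMap e S) p) (κF.symm (sourceMap S p)) := by
      rw [hFinv p hp, hHeq]
      exact ((h'.contDiffAt_targetMap hp).differentiableAt (by norm_num)).hasFDerivAt
    exact h1.comp _ hLd
  refine ⟨V', κ, hsub, h'.base_mem, h'.conic, hprod, ⟨?_, ?_, ?_⟩, hκs, hκt, hκe⟩
  · rw [hκs]
    rintro _ ⟨p, hp, rfl⟩
    obtain ⟨L, -, hL⟩ := hder p hp
    exact hL.differentiableAt.differentiableWithinAt
  · rw [hκt]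
    rintro _ ⟨p, hp, rfl⟩
    obtain ⟨L, -, hL⟩ := hHd p hp
    have h1 : DifferentiableAt ℂ κF (κH.symm (targetMap e S p)) := by
      rw [hHinv p hp, hFeq]
      exact (h'.contDiffAt_sourceMap hp).differentiableAt (by norm_num)
    exact (h1.comp _ hL.differentiableAt).differentiableWithinAt
  · rw [hκs]
    rintro _ ⟨p, hp, rfl⟩ u v
    obtain ⟨L, hL, hLd⟩ := hder p hp
    have h2 : ∀ w, fderiv ℂ (sourceMap S) p (L.symm w) = w := fun w => by
      rw [← hL]; exact L.apply_symm_apply w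
    rw [hLd.fderiv, ContinuousLinearMap.comp_apply, ContinuousLinearMap.comp_apply,
      sympl_fderiv_targetMap h'.isOpen h'.holomorphic hp]
    simp only [ContinuousLinearEquiv.coe_coe, h2]

end IsConicGenerator

variable {d : ℕ} {η₀ : Fin d → ℝ} {W : Set (Cn d)} {G : Cn d → Matrix (Fin d) (Fin d) ℂ}
  {U : Set (Cn d × (Fin d → ℂ))} {φ : Cn d → (Fin d → ℂ) → ℂ}

/-! ### Partial gradients of ψ. -/

section PartialDerivatives

variable {f : Cn d → (Fin d → ℂ) → ℂ} {y : Cn d} {ξ : Fin d → ℂ}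

/-- `dotProduct a` as a continuous linear map. -/
noncomputable def dotL (a : Fin d → ℂ) : (Fin d → ℂ) →L[ℂ] ℂ :=
  LinearMap.toContinuousLinearMap (dotProductBilin ℂ ℂ a)

@[simp] theorem dotL_apply (a b : Fin d → ℂ) : dotL a b = dotProduct a b := rfl

theorem fgrad_psi (hf : DifferentiableAt ℂ (fun q : Cn d × (Fin d → ℂ) => f q.1 q.2) (y, ξ)) :
    fgrad (psi f y) ξ = fun j =>
      fderiv ℂ (fun q : Cn d × (Fin d → ℂ) => f q.1 q.2) (y, ξ) (0, Pi.single j 1) - y.1 j := by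
  have h1 := hf.hasFDerivAt.comp ξ (hasFDerivAt_prodMk_right (𝕜 := ℂ) y ξ)
  have h2 := h1.sub (dotL y.1).hasFDerivAt
  ext j
  rw [fgrad, show fderiv ℂ (psi f y) ξ = _ from h2.fderiv]
  simp

theorem grad_psi (hf : DifferentiableAt ℂ (fun q : Cn d × (Fin d → ℂ) => f q.1 q.2) (y, ξ)) :
    grad (fun z => psi f z ξ) y =
      (fun j => fderiv ℂ (fun q : Cn d × (Fin d → ℂ) => f q.1 q.2) (y, ξ)
        ((Pi.single j 1, 0), 0) - ξ j,
      fderiv ℂ (fun q : Cn d × (Fin d → ℂ) => f q.1 q.2) (y, ξ) ((0, 1), 0)) := by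
  have h1 := hf.hasFDerivAt.comp y (hasFDerivAt_prodMk_left (𝕜 := ℂ) y ξ)
  have h0 : HasFDerivAt (fun z : Cn d => dotProduct z.1 ξ)
      ((dotL ξ).comp (ContinuousLinearMap.fst ℂ (Fin d → ℂ) ℂ)) y := by
    have := ((dotL ξ).comp (ContinuousLinearMap.fst ℂ (Fin d → ℂ) ℂ)).hasFDerivAt (x := y)
    refine this.congr_of_eventuallyEq (Eventually.of_forall fun z => ?_)
    simp [dotProduct_comm]
  have h2 := h1.sub h0
  rw [grad, show fderiv ℂ (fun z => psi f z ξ) y = _ from h2.fderiv]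
  simp

end PartialDerivatives

section Conjugation

/-- Conjugating both the argument and the value composes two antilinear maps with a linear one, so
the derivative is again complex linear. -/
theorem hasFDerivAt_starFun {y : Cn d} {η : Fin d → ℂ} (hφ : DifferentiableAt ℂ
      (fun q : Cn d × (Fin d → ℂ) => φ q.1 q.2) (conjCn y, conjVec η)) :
    HasFDerivAt (fun q : Cn d × (Fin d → ℂ) => starFun φ q.1 q.2)
      ((starL ℂ : ℂ ≃L⋆[ℂ] ℂ).toContinuousLinearMap.comp
        ((fderiv ℂ (fun q : Cn d × (Fin d → ℂ) => φ q.1 q.2) (conjCn y, conjVec η)).comp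
          (starL ℂ : (Cn d × (Fin d → ℂ)) ≃L⋆[ℂ] _).toContinuousLinearMap)) (y, η) := by
  have h := hφ.hasFDerivAt.star_star
  have e : star ((conjCn y, conjVec η) : Cn d × (Fin d → ℂ)) = (y, η) :=
    star_star ((y, η) : Cn d × (Fin d → ℂ))
  rw [e] at h
  exact h

theorem conjVec_smul_real (c : ℝ) (η : Fin d → ℂ) : conjVec ((c : ℂ) • η) = (c : ℂ) • conjVec η := by
  ext j; simp [conjVec]

theorem conjVec_realVec (a : Fin d → ℝ) : conjVec (realVec a) = realVec a := by
  ext j; simp [conjVec, realVec]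

theorem conj_dotProduct_conjVec (a b : Fin d → ℂ) :
    (starRingEnd ℂ) (dotProduct (conjVec a) (conjVec b)) = dotProduct a b := by
  simp [dotProduct, conjVec]

end Conjugation

/-! ### The relation of the phase in terms of its generating function. -/

section Phase

/-- The generating function `φ(y, t η₀) - φ*(y, η)`. -/
noncomputable def genFun (η₀ : Fin d → ℝ) (φ : Cn d → (Fin d → ℂ) → ℂ) (p : TCn d) : ℂ :=
  φ p.1 (p.2.2 • realVec η₀) - starFun φ p.1 p.2.1

/-- The domain of the generating function. -/
def genDomain (η₀ : Fin d → ℝ) (U : Set (Cn d × (Fin d → ℂ))) : Set (TCn d) :=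
  {p | (p.1, p.2.2 • realVec η₀) ∈ U ∧ (conjCn p.1, conjVec p.2.1) ∈ U}

/-- The corrections y'·tη₀ and y'·η in ψ and ψ* cancel −y'·(η − tη₀), leaving x' in a bilinear term
only. -/
theorem phase_eq (X y : Cn d) (η : Fin d → ℂ) :
    phase η₀ φ X y η =
      genFun η₀ φ (y, (η, X.2)) + dotProduct X.1 (η - X.2 • realVec η₀) := by
  simp only [phase, psi, psiStar, genFun, sub_dotProduct, dotProduct_sub]
  ring

variable (hφ : IsHJSolution W G η₀ U φ) {p : TCn d} (hp : p ∈ genDomain η₀ U)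
include hφ hp

theorem differentiableAt_starFun :
    DifferentiableAt ℂ (fun q : Cn d × (Fin d → ℂ) => starFun φ q.1 q.2) (p.1, p.2.1) :=
  (hasFDerivAt_starFun (hφ.differentiableAt hp.2)).differentiableAt

theorem hasFDerivAt_genFun :
    HasFDerivAt (genFun η₀ φ)
      ((fderiv ℂ (fun q : Cn d × (Fin d → ℂ) => φ q.1 q.2) (p.1, p.2.2 • realVec η₀)).comp
        ((ContinuousLinearMap.fst ℂ (Cn d) (Cn d)).prod
          (((ContinuousLinearMap.snd ℂ (Fin d → ℂ) ℂ).comp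
            (ContinuousLinearMap.snd ℂ (Cn d) (Cn d))).smulRight (realVec η₀))) -
      (fderiv ℂ (fun q : Cn d × (Fin d → ℂ) => starFun φ q.1 q.2) (p.1, p.2.1)).comp
        ((ContinuousLinearMap.fst ℂ (Cn d) (Cn d)).prod
          ((ContinuousLinearMap.fst ℂ (Fin d → ℂ) ℂ).comp
            (ContinuousLinearMap.snd ℂ (Cn d) (Cn d))))) p := by
  have h1 := (hφ.differentiableAt hp.1).hasFDerivAt.comp p (ContinuousLinearMap.hasFDerivAt
    ((ContinuousLinearMap.fst ℂ (Cn d) (Cn d)).prod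
          (((ContinuousLinearMap.snd ℂ (Fin d → ℂ) ℂ).comp
            (ContinuousLinearMap.snd ℂ (Cn d) (Cn d))).smulRight (realVec η₀))))
  have h2 := (differentiableAt_starFun hφ hp).hasFDerivAt.comp p (ContinuousLinearMap.hasFDerivAt
    ((ContinuousLinearMap.fst ℂ (Cn d) (Cn d)).prod
          ((ContinuousLinearMap.fst ℂ (Fin d → ℂ) ℂ).comp
            (ContinuousLinearMap.snd ℂ (Cn d) (Cn d)))))
  exact h1.sub h2

theorem fderiv_genFun_apply (u : Cn d) (ζ : Fin d → ℂ) (τ : ℂ) :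
    fderiv ℂ (genFun η₀ φ) p (u, (ζ, τ)) =
      fderiv ℂ (fun q : Cn d × (Fin d → ℂ) => φ q.1 q.2) (p.1, p.2.2 • realVec η₀)
        (u, τ • realVec η₀) -
      fderiv ℂ (fun q : Cn d × (Fin d → ℂ) => starFun φ q.1 q.2) (p.1, p.2.1) (u, ζ) := by
  rw [(hasFDerivAt_genFun hφ hp).fderiv]
  rfl

theorem fgrad_phase (x' : Fin d → ℂ) :
    fgrad (fun θ => phase η₀ φ (x', p.2.2) p.1 θ) p.2.1 =
      fun j => fderiv ℂ (genFun η₀ φ) p (0, (Pi.single j 1, 0)) + x' j := by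
  have h1 : HasFDerivAt (fun θ : Fin d → ℂ => ((p.1, (θ, p.2.2)) : TCn d))
      ((ContinuousLinearMap.inr ℂ (Cn d) (Cn d)).comp (ContinuousLinearMap.inl ℂ (Fin d → ℂ) ℂ))
      p.2.1 :=
    (hasFDerivAt_prodMk_right (𝕜 := ℂ) p.1 p.2).comp p.2.1
      (hasFDerivAt_prodMk_left (𝕜 := ℂ) p.2.1 p.2.2)
  have h2 := ((hasFDerivAt_genFun hφ hp).differentiableAt.hasFDerivAt.comp p.2.1
    (f := fun θ : Fin d → ℂ => ((p.1, (θ, p.2.2)) : TCn d)) h1).add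
    ((dotL x').hasFDerivAt.comp p.2.1 ((hasFDerivAt_id p.2.1).sub_const (p.2.2 • realVec η₀)))
  ext j
  simp only [fgrad, phase_eq]
  rw [show fderiv ℂ (fun θ : Fin d → ℂ => genFun η₀ φ (p.1, (θ, p.2.2)) +
    dotProduct x' (θ - p.2.2 • realVec η₀)) p.2.1 = _ from h2.fderiv]
  simp

theorem grad_phase_target (x' : Fin d → ℂ) :
    grad (fun Z => phase η₀ φ Z p.1 p.2.1) (x', p.2.2) =
      (p.2.1 - p.2.2 • realVec η₀,
        fderiv ℂ (genFun η₀ φ) p (0, (0, 1)) - dotProduct x' (realVec η₀)) := by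
  have h1 : HasFDerivAt (fun Z : Cn d => ((p.1, (p.2.1, Z.2)) : TCn d))
      ((ContinuousLinearMap.inr ℂ (Cn d) (Cn d)).comp ((ContinuousLinearMap.inr ℂ (Fin d → ℂ) ℂ).comp
        (ContinuousLinearMap.snd ℂ (Fin d → ℂ) ℂ))) (x', p.2.2) :=
    (hasFDerivAt_prodMk_right (𝕜 := ℂ) p.1 p.2).comp (x', p.2.2)
      ((hasFDerivAt_prodMk_right (𝕜 := ℂ) p.2.1 p.2.2).comp (x', p.2.2) hasFDerivAt_snd)
  have h2 : HasFDerivAt (fun Z : Cn d => dotProduct Z.1 (p.2.1 - Z.2 • realVec η₀))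
      ((dotL (p.2.1 - p.2.2 • realVec η₀)).comp (ContinuousLinearMap.fst ℂ (Fin d → ℂ) ℂ) -
        (dotProduct x' (realVec η₀)) • ContinuousLinearMap.snd ℂ (Fin d → ℂ) ℂ) (x', p.2.2) := by
    have e1 : (fun Z : Cn d => dotProduct Z.1 (p.2.1 - Z.2 • realVec η₀)) = fun Z =>
        dotL p.2.1 Z.1 - Z.2 * dotL (realVec η₀) Z.1 := by
      ext Z
      simp [dotProduct_sub, dotProduct_comm]
    rw [e1]
    have ha : ∀ a : Fin d → ℂ, HasFDerivAt (fun Z : Cn d => dotL a Z.1)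
        ((dotL a).comp (ContinuousLinearMap.fst ℂ (Fin d → ℂ) ℂ)) (x', p.2.2) := fun a =>
      ((dotL a).comp (ContinuousLinearMap.fst ℂ (Fin d → ℂ) ℂ)).hasFDerivAt
    have hs : HasFDerivAt (fun Z : Cn d => Z.2) (ContinuousLinearMap.snd ℂ (Fin d → ℂ) ℂ)
        (x', p.2.2) := hasFDerivAt_snd
    refine ((ha p.2.1).fun_sub (hs.fun_mul (ha (realVec η₀)))).congr_fderiv ?_
    ext v <;> simp [dotProduct_comm]
  have h3 := ((hasFDerivAt_genFun hφ hp).differentiableAt.hasFDerivAt.comp (x', p.2.2)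
    (f := fun Z : Cn d => ((p.1, (p.2.1, Z.2)) : TCn d)) h1).fun_add h2
  simp only [grad, phase_eq]
  rw [show fderiv ℂ (fun Z : Cn d => genFun η₀ φ (p.1, (p.2.1, Z.2)) +
    dotProduct Z.1 (p.2.1 - Z.2 • realVec η₀)) (x', p.2.2) = _ from h3.fderiv]
  refine Prod.ext ?_ ?_
  · ext j
    have h0 : fderiv ℂ (genFun η₀ φ) p (0, (0, 0)) = 0 := map_zero _
    simp [h0]
  · simp [sub_eq_add_neg]

theorem grad_phase_source (x' : Fin d → ℂ) :
    grad (fun z => phase η₀ φ (x', p.2.2) z p.2.1) p.1 =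
      (fun j => fderiv ℂ (genFun η₀ φ) p ((Pi.single j 1, 0), 0),
        fderiv ℂ (genFun η₀ φ) p ((0, 1), 0)) := by
  have h1 := ((hasFDerivAt_genFun hφ hp).differentiableAt.hasFDerivAt.comp p.1
    (f := fun z : Cn d => ((z, p.2) : TCn d)) (hasFDerivAt_prodMk_left (𝕜 := ℂ) p.1 p.2)).add_const
      (dotProduct x' (p.2.1 - p.2.2 • realVec η₀))
  simp only [grad, phase_eq]
  rw [show fderiv ℂ (fun z : Cn d => genFun η₀ φ (z, (p.2.1, p.2.2)) +
    dotProduct x' (p.2.1 - p.2.2 • realVec η₀)) p.1 = _ from h1.fderiv]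
  rfl

omit hp

/-- The stationarity condition reads ∂_η S + x' = 0 and is solved uniquely for x'; substituting it
into ∂_t Φ produces the term η₀·∂_η S. -/
theorem canonicalRelation_eq :
    canonicalRelation (phaseDomain η₀ U) (phase η₀ φ) =
      {ρ | ∃ p ∈ genDomain η₀ U,
        ρ = (targetMap (realVec η₀) (genFun η₀ φ) p, sourceMap (genFun η₀ φ) p)} := by
  have key : ∀ p ∈ genDomain η₀ U, ∀ x' : Fin d → ℂ,
      fgrad (fun θ => phase η₀ φ (x', p.2.2) p.1 θ) p.2.1 = 0 →
      ((((x', p.2.2) : Cn d), grad (fun Z => phase η₀ φ Z p.1 p.2.1) (x', p.2.2)),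
        (p.1, -grad (fun z => phase η₀ φ (x', p.2.2) z p.2.1) p.1)) =
        (targetMap (realVec η₀) (genFun η₀ φ) p, sourceMap (genFun η₀ φ) p) := by
    intro p hp x' hx
    rw [fgrad_phase hφ hp] at hx
    have hx' : x' = fun j => -fderiv ℂ (genFun η₀ φ) p (0, (Pi.single j 1, 0)) := by
      ext j
      exact (neg_eq_of_add_eq_zero_right (congrFun hx j)).symm
    rw [grad_phase_target hφ hp, grad_phase_source hφ hp, targetMap, sourceMap,
      clm_TCn_apply_snd _ (realVec η₀) 1, ← hx']
    refine Prod.ext (Prod.ext rfl (Prod.ext rfl ?_)) rfl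
    rw [hx']
    have hneg : ∀ a : Fin d → ℂ, (fun j => -a j) = -a := fun a => rfl
    simp only [hneg, neg_dotProduct]
    ring
  ext ρ
  constructor
  · rintro ⟨⟨x', t⟩, y, η, hD, hx, rfl⟩
    exact ⟨(y, (η, t)), hD, key (y, (η, t)) hD x' hx⟩
  · rintro ⟨p, hp, rfl⟩
    have hx : fgrad (fun θ => phase η₀ φ
        ((fun j => -fderiv ℂ (genFun η₀ φ) p (0, (Pi.single j 1, 0))), p.2.2) p.1 θ) p.2.1 = 0 := by
      rw [fgrad_phase hφ hp]
      ext j; simp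
    exact ⟨((fun j => -fderiv ℂ (genFun η₀ φ) p (0, (Pi.single j 1, 0))), p.2.2), p.1, p.2.1, hp, hx,
      (key p hp _ hx).symm⟩

theorem explicitRelation_eq :
    explicitRelation η₀ U φ =
      {ρ | ∃ p ∈ genDomain η₀ U,
        ρ = (targetMap (realVec η₀) (genFun η₀ φ) p, sourceMap (genFun η₀ φ) p)} := by
  have key : ∀ p ∈ genDomain η₀ U,
      ((((p.1.1 + fgrad (psiStar φ p.1) p.2.1, p.2.2),
          (p.2.1 - p.2.2 • realVec η₀,
            dotProduct (realVec η₀) (fgrad (psi φ p.1) (p.2.2 • realVec η₀))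
              - dotProduct (realVec η₀) (fgrad (psiStar φ p.1) p.2.1))) : TCn d),
         ((p.1,
          (-(grad (fun z => psi φ z (p.2.2 • realVec η₀)) p.1).1
              + (grad (fun z => psiStar φ z p.2.1) p.1).1 + p.2.1 - p.2.2 • realVec η₀,
            -(grad (fun z => psi φ z (p.2.2 • realVec η₀)) p.1).2
              + (grad (fun z => psiStar φ z p.2.1) p.1).2)) : TCn d)) =
        (targetMap (realVec η₀) (genFun η₀ φ) p, sourceMap (genFun η₀ φ) p) := by
    intro p hp
    have hd := hφ.differentiableAt hp.1
    have hs := differentiableAt_starFun hφ hp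
    have e1 : psiStar φ = psi (starFun φ) := rfl
    rw [e1, fgrad_psi hd, fgrad_psi hs, grad_psi hd, grad_psi hs, targetMap, sourceMap]
    have e2 : ∀ u : Cn d, ((u, 0) : TCn d) = (u, (0, 0)) := fun u => rfl
    simp only [e2, fderiv_genFun_apply hφ hp, zero_smul, one_smul]
    have hsum : ∀ L : (Cn d × (Fin d → ℂ)) →L[ℂ] ℂ, L (0, realVec η₀) =
        dotProduct (realVec η₀) (fun j => L (0, Pi.single j 1)) := by
      intro L
      conv_lhs => rw [pi_sum_single (realVec η₀)]
      have : ((0, ∑ j, realVec η₀ j • (Pi.single j 1 : Fin d → ℂ)) : Cn d × (Fin d → ℂ)) =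
          ∑ j, realVec η₀ j • ((0, Pi.single j 1) : Cn d × (Fin d → ℂ)) := by
        refine Prod.ext ?_ ?_ <;> simp [Prod.fst_sum, Prod.snd_sum]
      rw [this, map_sum]
      simp only [map_smul, smul_eq_mul, dotProduct]
    have hsub : ∀ a b : Fin d → ℂ, (fun j => a j - b j) = a - b := fun a b => rfl
    have h00 : ∀ L : (Cn d × (Fin d → ℂ)) →L[ℂ] ℂ, L (0, 0) = 0 := fun L => L.map_zero
    refine Prod.ext (Prod.ext (Prod.ext ?_ rfl) (Prod.ext rfl ?_)) (Prod.ext rfl (Prod.ext ?_ ?_))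
    · ext j
      simp [h00]
    · simp only [hsum, hsub, dotProduct_sub]
      ring
    · ext j
      simp only [Pi.add_apply, Pi.sub_apply, Pi.neg_apply]
      ring
    · simp only
      ring
  ext ρ
  constructor
  · rintro ⟨y, t, η, h1, h2, rfl⟩
    exact ⟨(y, (η, t)), ⟨h1, h2⟩, key (y, (η, t)) ⟨h1, h2⟩⟩
  · rintro ⟨p, hp, rfl⟩
    exact ⟨p.1, p.2.2, p.2.1, hp.1, hp.2, (key p hp).symm⟩

end Phase

/-! ### The hypotheses on φ yield a conic generator. -/

section Generator

variable (hφ : IsHJSolution W G η₀ U φ)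
include hφ

theorem IsHJSolution.exists_cone (hG : IsEllipticSymbol W G)
    (hη₀ : symbol G 0 (realVec η₀) = 1 / 4) :
    ∃ ε > 0, ∃ K : Set (Fin d → ℂ), IsOpen K ∧ realVec η₀ ∈ K ∧
      (∀ ξ ∈ K, ∀ c : ℝ, 0 < c → (c : ℂ) • ξ ∈ K) ∧
      ∀ y ∈ ball (0 : Cn d) ε, ∀ ξ ∈ K, (y, ξ) ∈ U ∧
        ∀ c : ℝ, 0 < c → φ y ((c : ℂ) • ξ) = c * φ y ξ := by
  obtain ⟨ε, hε, h⟩ := hφ.homogeneous hG hη₀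
  have hinv : ∀ {c : ℝ}, 0 < c → ∀ ξ : Fin d → ℂ, ((c⁻¹ : ℝ) : ℂ) • (c : ℂ) • ξ = ξ := by
    intro c hc ξ
    rw [smul_smul, ← Complex.ofReal_mul, inv_mul_cancel₀ hc.ne']
    simp
  -- The cone over the ball. Homogeneity on it follows by applying the ball statement twice, with
  -- factors a⁻¹ and c a⁻¹.
  refine ⟨ε, hε, {ξ | ∃ c : ℝ, 0 < c ∧ (c : ℂ) • ξ ∈ ball (realVec η₀) ε}, ?_, ?_, ?_, ?_⟩
  · have : {ξ : Fin d → ℂ | ∃ c : ℝ, 0 < c ∧ (c : ℂ) • ξ ∈ ball (realVec η₀) ε} =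
        ⋃ c : Ioi (0 : ℝ), (fun ξ => ((c : ℝ) : ℂ) • ξ) ⁻¹' ball (realVec η₀) ε := by
      ext ξ; simp
    rw [this]
    exact isOpen_iUnion fun c => isOpen_ball.preimage (by fun_prop)
  · exact ⟨1, one_pos, by simpa using hε⟩
  · rintro ξ ⟨a, ha, hξ⟩ c hc
    refine ⟨a * c⁻¹, by positivity, ?_⟩
    rw [Complex.ofReal_mul, mul_smul, hinv hc]
    exact hξ
  · rintro y hy ξ ⟨a, ha, hξ⟩
    have h1 := h y hy _ hξ a⁻¹ (inv_pos.2 ha)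
    rw [hinv ha] at h1
    refine ⟨h1.1, fun c hc => ?_⟩
    have h2 := h y hy _ hξ (c * a⁻¹) (by positivity)
    rw [Complex.ofReal_mul, mul_smul, hinv ha] at h2
    rw [h2.2, h1.2]
    ring

/-- The one place where the branch of the root matters: the principal root of 1/4 is 1/2. -/
theorem fderiv_phi_normal (hη₀ : symbol G 0 (realVec η₀) = 1 / 4) :
    fderiv ℂ (fun q : Cn d × (Fin d → ℂ) => φ q.1 q.2) (0, realVec η₀) ((0, 1), 0) =
      Complex.I / 2 := by
  have h := hφ.eikonal 0 (realVec η₀) hφ.base_mem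
  simp only [grad, hφ.fderiv_base hφ.base_mem] at h
  have h3 : (fun j => fderiv ℂ (fun p : Cn d × (Fin d → ℂ) => φ p.1 p.2) (0, realVec η₀)
      ((Pi.single j 1, 0), 0)) = realVec η₀ := by
    ext j
    have := hφ.fderiv_initial (y' := 0) (ξ := realVec η₀) hφ.base_mem (Pi.single j 1) 0
    simp only [single_one_dotProduct, dotProduct_zero, add_zero] at this
    exact this
  have h4 : ((1 / 4 : ℂ)) ^ (1 / 2 : ℂ) = 1 / 2 := by
    have e : ((1 / 4 : ℝ)) ^ (1 / 2 : ℝ) = 1 / 2 := by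
      rw [← Real.sqrt_eq_rpow, show (1 / 4 : ℝ) = (1 / 2) ^ 2 by norm_num]
      exact Real.sqrt_sq (by norm_num)
    have := Complex.ofReal_cpow (x := 1 / 4) (by norm_num) (1 / 2)
    rw [e] at this
    push_cast at this
    exact this.symm
  rw [h3, hη₀, h4] at h
  rw [h]; ring

theorem exists_isConicGenerator (hG : IsEllipticSymbol W G)
    (hη₀ : symbol G 0 (realVec η₀) = 1 / 4) :
    ∃ V ⊆ genDomain η₀ U, IsConicGenerator (realVec η₀) V (genFun η₀ φ) := by
  obtain ⟨ε, hε, K, hK, hηK, hKc, hU⟩ := hφ.exists_cone hG hη₀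
  have hball : ∀ {y : Cn d}, y ∈ ball (0 : Cn d) ε → conjCn y ∈ ball (0 : Cn d) ε := by
    intro y hy
    rw [mem_ball_zero_iff] at hy ⊢
    exact (norm_star y).trans_lt hy
  set V : Set (TCn d) := {p | p.1 ∈ ball (0 : Cn d) ε ∧ p.2.2 • realVec η₀ ∈ K ∧
    conjVec p.2.1 ∈ K} with hV
  have hVΩ : V ⊆ genDomain η₀ U := fun p hp =>
    ⟨(hU _ hp.1 _ hp.2.1).1, (hU _ (hball hp.1) _ hp.2.2).1⟩
  have hbase : ((0, (realVec η₀, 1)) : TCn d) ∈ V := by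
    refine ⟨mem_ball_self hε, ?_, ?_⟩
    · simpa using hηK
    · simpa [conjVec_realVec] using hηK
  refine ⟨V, hVΩ, ?_, hbase, ?_, ?_, ?_, ?_, ?_⟩
  · exact (isOpen_ball.preimage continuous_fst).inter
      ((hK.preimage (by fun_prop : Continuous fun p : TCn d => p.2.2 • realVec η₀)).inter
        (hK.preimage ((continuous_star (R := Fin d → ℂ)).comp (continuous_fst.comp continuous_snd))))
  · rintro p ⟨h1, h2, h3⟩ c hc
    refine ⟨h1, ?_, ?_⟩
    · simpa [dilSource, mul_smul] using hKc _ h2 c hc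
    · have := hKc _ h3 c hc
      rwa [← conjVec_smul_real] at this
  · exact fun p hp =>
      (hasFDerivAt_genFun hφ (hVΩ hp)).differentiableAt.differentiableWithinAt
  · rintro p ⟨h1, h2, h3⟩ c hc
    simp only [genFun, dilSource, starFun, Prod.smul_fst, Prod.smul_snd, smul_eq_mul, mul_smul,
      conjVec_smul_real]
    rw [(hU _ h1 _ h2).2 c hc, (hU _ (hball h1) _ h3).2 c hc, map_mul, Complex.conj_ofReal]
    ring
  · intro y' η t hp
    have h1 := hφ.initial y' _ (hVΩ hp).1
    have e1 : conjCn ((y', 0) : Cn d) = (conjVec y', 0) := by simp [conjCn]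
    have h2 := hφ.initial (conjVec y') (conjVec η) (by rw [← e1]; exact (hVΩ hp).2)
    simp only [genFun, starFun]
    rw [h1, e1, h2, conj_dotProduct_conjVec, dotProduct_sub]
  -- The contribution of φ is i/2 and that of φ* its conjugate −i/2, so their difference is i.
  · have h1 := fderiv_genFun_apply hφ (hVΩ hbase) (0, 1) 0 0
    refine h1.trans ?_
    simp only [one_smul, zero_smul]
    have h2 : (((conjCn 0, conjVec (realVec η₀)) : Cn d × (Fin d → ℂ))) = (0, realVec η₀) := by
      rw [conjVec_realVec]
      exact congrArg (fun z : Cn d => (z, realVec η₀)) (star_zero (Cn d))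
    have h3 := hasFDerivAt_starFun (φ := φ) (y := 0) (η := realVec η₀)
      (by rw [h2]; exact hφ.differentiableAt hφ.base_mem)
    rw [h2] at h3
    rw [h3.fderiv, fderiv_phi_normal hφ hη₀]
    have h4 : star (((0, 1), 0) : Cn d × (Fin d → ℂ)) = ((0, 1), 0) := by
      refine Prod.ext (Prod.ext ?_ ?_) ?_ <;> simp
    change Complex.I / 2 - star (fderiv ℂ (fun q : Cn d × (Fin d → ℂ) => φ q.1 q.2)
      (0, realVec η₀) (star ((0, 1), 0))) = Complex.I
    rw [h4, fderiv_phi_normal hφ hη₀]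
    simp
    ring

end Generator

end DNSymbol

/-! ### The canonical relation as the graph of a homogeneous canonical transformation. -/

theorem proposition3p1 {d : ℕ} (η₀ : Fin d → ℝ)
    (W : Set (DNSymbol.Cn d)) (G : DNSymbol.Cn d → Matrix (Fin d) (Fin d) ℂ)
    (hG : DNSymbol.IsEllipticSymbol W G)
    (hη₀ : DNSymbol.symbol G 0 (DNSymbol.realVec η₀) = 1 / 4)
    (U : Set (DNSymbol.Cn d × (Fin d → ℂ))) (φ : DNSymbol.Cn d → (Fin d → ℂ) → ℂ)
    (hφ : DNSymbol.IsHJSolution W G η₀ U φ) :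
    DNSymbol.canonicalRelation (DNSymbol.phaseDomain η₀ U) (DNSymbol.phase η₀ φ) =
        DNSymbol.explicitRelation η₀ U φ ∧
    ∃ κ : OpenPartialHomeomorph (DNSymbol.TCn d) (DNSymbol.TCn d),
      DNSymbol.IsCanonicalTransformation κ ∧
      ((0, 0), (0, -Complex.I)) ∈ κ.source ∧
      ((0, 1), (0, 0)) ∈ κ.target ∧
      κ ((0, 0), (0, -Complex.I)) = ((0, 1), (0, 0)) ∧
      (∀ ρ ∈ κ.source, ∀ c : ℝ, 0 < c → DNSymbol.dilSource c ρ ∈ κ.source) ∧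
      (∀ ρ ∈ κ.target, ∀ c : ℝ, 0 < c → DNSymbol.dilTarget c ρ ∈ κ.target) ∧
      (∀ ρ ∈ κ.source, ∀ c : ℝ, 0 < c →
        κ (DNSymbol.dilSource c ρ) = DNSymbol.dilTarget c (κ ρ)) ∧
      DNSymbol.IsGraphOf
        (DNSymbol.canonicalRelation (DNSymbol.phaseDomain η₀ U) (DNSymbol.phase η₀ φ)) κ := by
  rw [DNSymbol.explicitRelation_eq hφ, DNSymbol.canonicalRelation_eq hφ]
  refine ⟨rfl, ?_⟩
  obtain ⟨V, hVΩ, hgen⟩ := DNSymbol.exists_isConicGenerator hφ hG hη₀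
  obtain ⟨V', κ, hsub, hbase, hconic, hprod, hcan, hsource, htarget, hκ⟩ :=
    hgen.exists_canonicalTransformation
  have hs := hgen.sourceMap_base
  have ht := hgen.targetMap_base
  refine ⟨κ, hcan, ?_, ?_, ?_, ?_, ?_, ?_, ?_⟩
  · rw [hsource, ← hs]
    exact Set.mem_image_of_mem _ hbase
  · rw [htarget, ← ht]
    exact Set.mem_image_of_mem _ hbase
  · rw [← hs, hκ _ hbase, ht]
  · rw [hsource]
    rintro _ ⟨p, hp, rfl⟩ c hc
    exact ⟨_, hconic p hp c hc, hgen.sourceMap_dilSource (hsub hp) hc⟩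
  · rw [htarget]
    rintro _ ⟨p, hp, rfl⟩ c hc
    exact ⟨_, hconic p hp c hc, hgen.targetMap_dilSource (hsub hp) hc⟩
  · rw [hsource]
    rintro _ ⟨p, hp, rfl⟩ c hc
    rw [← hgen.sourceMap_dilSource (hsub hp) hc, hκ _ (hconic p hp c hc), hκ p hp,
      hgen.targetMap_dilSource (hsub hp) hc]
  · ext ρ
    simp only [Set.mem_inter_iff, Set.mem_ofPred_eq, Set.mem_prod, hsource, htarget]
    constructor
    -- A priori p is any point of the relation, with its two images attained at different points q
    -- and r of V'. The source image gives p the y of r, the target image gives it the (η, t) of q,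
    -- and the product property puts p in V'.
    · rintro ⟨⟨p, hp, rfl⟩, ⟨q, hq, hqt⟩, ⟨r, hr, hrs⟩⟩
      have h1 : p.1 = r.1 := (congrArg Prod.fst hrs).symm
      have h2 : p.2.2 = q.2.2 := congrArg (fun ρ : DNSymbol.TCn d => ρ.1.2) hqt.symm
      have h3 : p.2.1 = q.2.1 := by
        have : q.2.1 - q.2.2 • DNSymbol.realVec η₀ = p.2.1 - p.2.2 • DNSymbol.realVec η₀ :=
          congrArg (fun ρ : DNSymbol.TCn d => ρ.2.1) hqt
        rw [h2] at this
        exact (sub_left_injective this).symm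
      have hpV : p ∈ V' := by
        have := hprod r hr q hq
        rwa [← h1, ← Prod.ext h3 h2] at this
      exact ⟨⟨p, hpV, rfl⟩, (hκ p hpV).symm⟩
    · rintro ⟨⟨p, hp, hps⟩, h1⟩
      have h2 : ρ.1 = DNSymbol.targetMap (DNSymbol.realVec η₀) (DNSymbol.genFun η₀ φ) p := by
        rw [h1, ← hps, hκ p hp]
      exact ⟨⟨p, hVΩ (hsub hp), Prod.ext h2 hps.symm⟩, ⟨p, hp, h2.symm⟩, ⟨p, hp, hps⟩⟩
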